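/- Let $\mathcal{D}(\mathbb{R})$ be the space of smooth compactly supported functions on $\mathbb{R}$. For continuous $f:\mathbb{R}\to\mathbb{R}$ put $${\rm TV}^{(2)}(f)=\sup\Big\{\int_{\mathbb{R}} f(x)\varphi''(x)\,{\rm d}x:\ \varphi\in\mathcal{D}(\mathbb{R}),\ \|\varphi\|_{\infty}=1\Big\}\in[0,\infty],\qquad L(f)=\sup_{x_1\ne x_2}\frac{|f(x_1)-f(x_2)|}{|x_1-x_2|}\in[0,\infty],$$ and let ${\rm BV}^{(2)}(\mathbb{R})=\{f:\mathbb{R}\to\mathbb{R}\text{ continuous}:\ {\rm TV}^{(2)}(f)<\infty\}$. For $f\in{\rm BV}^{(2)}(\mathbb{R})$ the weak second derivative ${\rm D}^2f$ is a bounded Radon measure, i.e. an element of $\mathcal{M}(\mathbb{R})=C_0(\mathbb{R})'$. The map $f\mapsto({\rm D}^2f,f(0),f(1))$ identifies ${\rm BV}^{(2)}(\mathbb{R})$ with $\mathcal{M}(\mathbb{R})\times\mathbb{R}^2=(C_0(\mathbb{R})\times\mathbb{R}^2)'$; the weak*-topology on ${\rm BV}^{(2)}(\mathbb{R})$ is the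 one transported by this identification. Let $M\ge 2$, let $x_1<x_2<\cdots<x_M$ and $y_1,\dots,y_M$ be real numbers, let $\lambda>0$ and $\bar L>0$, and let $E:\mathbb{R}\times\mathbb{R}\to\mathbb{R}$ be such that, for every $y\in\mathbb{R}$, the function $E(\cdot,y)$ is strictly convex and coercive (i.e. $E(u,y)\to+\infty$ as $|u|\to\infty$). Let $$\mathcal{V}_{\rm hyb}=\operatorname*{arg\,min}_{f\in{\rm BV}^{(2)}(\mathbb{R})}\Big(\sum_{m=1}^M E(f(x_m),y_m)+\lambda\,{\rm TV}^{(2)}(f)\Big)\quad\text{subject to}\quad L(f)\le\bar L .$$ Then $\mathcal{V}_{\rm hyb}$ is a nonempty, convex and weak*-compact subset of ${\rm BV}^{(2)}(\mathbb{R})$, and each of its extreme points is a linear spline (a continuous piecewise-linear function) with at most $M-1$ linear regions. Moreover, there exists a unique vector ${\bf z}=(z_m)\in\mathbb{R}^M$ such that $$\mathcal{V}_{\rm hyb}=\operatorname*{arg\,min}_{f\in{\rm BV}^{(2)}(\mathbb{R})}{\rm TV}^{(2)}(f)\quad\text{subject to}\quad f(x_m)=z_m,\ 1\le m\le M .$$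 Finally, the optimal ${\rm TV}^{(2)}$ cost, i.e. the common value of ${\rm TV}^{(2)}(f)$ for $f\in\mathcal{V}_{\rm hyb}$, is $${\rm TV}_{\min}=\sum_{m=2}^{M-1}\left|\frac{z_m-z_{m-1}}{x_m-x_{m-1}}-\frac{z_m-z_{m+1}}{x_m-x_{m+1}}\right| .$$ -/

import Mathlib

open scoped ENNReal ZeroAtInfty Topology

theorem two_le_infty : (2 : WithTop ℕ∞) ≤ ((⊤ : ℕ∞) : WithTop ℕ∞) :=
  WithTop.coe_le_coe.2 (le_top : (2 : ℕ∞) ≤ ⊤)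

/-- The space `𝒟(ℝ)` of real-valued, smooth, compactly supported test functions on the line. -/
abbrev TestFn : Type := TestFunction (⊤ : TopologicalSpace.Opens ℝ) ℝ ⊤

theorem TestFn.contDiff' (φ : TestFn) : ContDiff ℝ (⊤ : ℕ∞) (φ : ℝ → ℝ) := φ.contDiff

theorem TestFn.hasCompactSupport' (φ : TestFn) : HasCompactSupport (φ : ℝ → ℝ) :=
  φ.hasCompactSupport

/-- The inclusion of `𝒟(ℝ)` in the Banach space `C₀(ℝ)` (sup norm). -/
noncomputable def TestFn.toC0 : TestFn →ₗ[ℝ] C₀(ℝ, ℝ) where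
  toFun φ :=
    { toFun := φ
      continuous_toFun := φ.contDiff'.continuous
      zero_at_infty' := φ.hasCompactSupport'.is_zero_at_infty }
  map_add' _ _ := rfl
  map_smul' _ _ := rfl

@[simp] theorem TestFn.toC0_apply (φ : TestFn) (x : ℝ) : TestFn.toC0 φ x = φ x := rfl

/-- The action `⟨D² f, φ⟩ = ⟨f, φ''⟩ = ∫ f φ''` of the distributional second derivative of `f`. -/
noncomputable def d2Pairing (f : ℝ → ℝ) (φ : TestFn) : ℝ :=
  ∫ x, f x * iteratedDeriv 2 φ x

/-- The second-order total variation
`TV⁽²⁾(f) = sup { ∫ f φ'' : φ ∈ 𝒟(ℝ), ‖φ‖_∞ = 1 } ∈ [0, ∞]`. -/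
noncomputable def TV2 (f : ℝ → ℝ) : ℝ≥0∞ :=
  ⨆ (φ : TestFn) (_ : ‖TestFn.toC0 φ‖ = 1), ENNReal.ofReal (d2Pairing f φ)

theorem TestFn.continuous_d2 (φ : TestFn) : Continuous (iteratedDeriv 2 (φ : ℝ → ℝ)) :=
  φ.contDiff'.continuous_iteratedDeriv 2 two_le_infty

theorem TestFn.hasCompactSupport_d2 (φ : TestFn) :
    HasCompactSupport (iteratedDeriv 2 (φ : ℝ → ℝ)) := by
  rw [iteratedDeriv_succ, iteratedDeriv_one]
  exact φ.hasCompactSupport'.deriv.deriv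

theorem integrable_mul_d2 {f : ℝ → ℝ} (hf : Continuous f) (φ : TestFn) :
    MeasureTheory.Integrable (fun x => f x * iteratedDeriv 2 φ x) :=
  (hf.mul φ.continuous_d2).integrable_of_hasCompactSupport φ.hasCompactSupport_d2.mul_left

theorem d2Pairing_add_left {f g : ℝ → ℝ} (hf : Continuous f) (hg : Continuous g) (φ : TestFn) :
    d2Pairing (f + g) φ = d2Pairing f φ + d2Pairing g φ := by
  simp only [d2Pairing, Pi.add_apply, add_mul]
  exact MeasureTheory.integral_add (integrable_mul_d2 hf φ) (integrable_mul_d2 hg φ)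

theorem d2Pairing_smul_left (c : ℝ) (f : ℝ → ℝ) (φ : TestFn) :
    d2Pairing (c • f) φ = c * d2Pairing f φ := by
  simp only [d2Pairing, Pi.smul_apply, smul_eq_mul, mul_assoc]
  exact MeasureTheory.integral_const_mul _ _

theorem d2Pairing_add_right {f : ℝ → ℝ} (hf : Continuous f) (φ ψ : TestFn) :
    d2Pairing f (φ + ψ) = d2Pairing f φ + d2Pairing f ψ := by
  have h : ∀ x, iteratedDeriv 2 (φ + ψ : TestFn) x
      = iteratedDeriv 2 φ x + iteratedDeriv 2 ψ x := fun x =>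
    iteratedDeriv_add (f := (φ : ℝ → ℝ)) (g := (ψ : ℝ → ℝ))
      (φ.contDiff'.contDiffAt.of_le two_le_infty)
      (ψ.contDiff'.contDiffAt.of_le two_le_infty)
  simp only [d2Pairing, h, mul_add]
  exact MeasureTheory.integral_add (integrable_mul_d2 hf φ) (integrable_mul_d2 hf ψ)

theorem d2Pairing_smul_right (f : ℝ → ℝ) (c : ℝ) (φ : TestFn) :
    d2Pairing f (c • φ) = c * d2Pairing f φ := by
  have h : ∀ x, iteratedDeriv 2 (c • φ : TestFn) x = c * iteratedDeriv 2 φ x := fun x =>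
    iteratedDeriv_const_mul_field (n := 2) (x := x) c (φ : ℝ → ℝ)
  simp only [d2Pairing, h, mul_left_comm]
  exact MeasureTheory.integral_const_mul _ _

theorem TV2_add_le {f g : ℝ → ℝ} (hf : Continuous f) (hg : Continuous g) :
    TV2 (f + g) ≤ TV2 f + TV2 g := by
  refine iSup₂_le fun φ hφ => ?_
  rw [d2Pairing_add_left hf hg]
  exact ENNReal.ofReal_add_le.trans
    (add_le_add (le_iSup₂_of_le φ hφ le_rfl) (le_iSup₂_of_le φ hφ le_rfl))

theorem d2Pairing_le {f : ℝ → ℝ} (hT : TV2 f < ⊤) {φ : TestFn} (hφ : ‖TestFn.toC0 φ‖ = 1) :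
    d2Pairing f φ ≤ (TV2 f).toReal := by
  have h : ENNReal.ofReal (d2Pairing f φ) ≤ TV2 f := le_iSup₂_of_le φ hφ le_rfl
  exact (ENNReal.ofReal_le_iff_le_toReal hT.ne).1 h

theorem abs_d2Pairing_le {f : ℝ → ℝ} (hT : TV2 f < ⊤) (φ : TestFn) :
    |d2Pairing f φ| ≤ (TV2 f).toReal * ‖TestFn.toC0 φ‖ := by
  by_cases h0 : ‖TestFn.toC0 φ‖ = 0
  · have h1 : φ = 0 := by
      ext x
      have h2 := norm_eq_zero.1 h0
      simpa using DFunLike.congr_fun h2 x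
    subst h1
    have h3 := d2Pairing_smul_right f 0 0
    rw [zero_smul, zero_mul] at h3
    simp [h3]
  · have hpos : 0 < ‖TestFn.toC0 φ‖ := lt_of_le_of_ne (norm_nonneg _) (Ne.symm h0)
    have key : ∀ s : ℝ, |s| = 1 → s * d2Pairing f φ ≤ (TV2 f).toReal * ‖TestFn.toC0 φ‖ := by
      intro s hs
      have h4 : ‖TestFn.toC0 ((s * ‖TestFn.toC0 φ‖⁻¹) • φ)‖ = 1 := by
        rw [map_smul, norm_smul, Real.norm_eq_abs, abs_mul, hs, one_mul, abs_inv, abs_norm,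
          inv_mul_cancel₀ h0]
      have h5 := d2Pairing_le hT h4
      rw [d2Pairing_smul_right] at h5
      calc s * d2Pairing f φ
          = (s * ‖TestFn.toC0 φ‖⁻¹ * d2Pairing f φ) * ‖TestFn.toC0 φ‖ := by field_simp
        _ ≤ _ := mul_le_mul_of_nonneg_right h5 hpos.le
    rw [abs_le]
    constructor
    · have := key (-1) (by simp)
      linarith
    · have := key 1 (by simp)
      linarith

theorem TV2_smul_lt_top (c : ℝ) {f : ℝ → ℝ} (hT : TV2 f < ⊤) : TV2 (c • f) < ⊤ := by
  refine lt_of_le_of_lt (iSup₂_le fun φ hφ => ?_)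
    (ENNReal.ofReal_lt_top (r := |c| * (TV2 f).toReal))
  refine ENNReal.ofReal_le_ofReal ?_
  rw [d2Pairing_smul_left]
  refine (le_abs_self _).trans ?_
  rw [abs_mul]
  refine mul_le_mul_of_nonneg_left ?_ (abs_nonneg c)
  simpa [hφ] using abs_d2Pairing_le hT φ

/-- The space `BV⁽²⁾(ℝ)` of functions with finite second-order total variation. A distribution
whose second derivative is a bounded measure is a continuous function, and its elements are
identified with their continuous representatives, so that point values make sense. -/
noncomputable def BV2 : Submodule ℝ (ℝ → ℝ) where
  carrier := {f | Continuous f ∧ TV2 f < ⊤}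
  add_mem' := fun {_ _} hf hg => ⟨hf.1.add hg.1,
    lt_of_le_of_lt (TV2_add_le hf.1 hg.1) (ENNReal.add_lt_top.2 ⟨hf.2, hg.2⟩)⟩
  zero_mem' := by
    refine ⟨continuous_zero, ?_⟩
    have h : TV2 0 = 0 := by simp [TV2, d2Pairing]
    simp [h]
  smul_mem' := fun c _ hf => ⟨hf.1.const_smul c, TV2_smul_lt_top c hf.2⟩

/-- Test functions are dense in `C₀(ℝ)`. -/
theorem TestFn.denseRange_toC0 : DenseRange TestFn.toC0 := by
  intro g
  rw [Metric.mem_closure_iff]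
  intro ε hε
  obtain ⟨h, hh, hgh⟩ := Continuous.exists_contDiff_approx (E := ℝ) ⊤ (f := (g : ℝ → ℝ))
    (ε := fun _ => ε / 4) g.continuous continuous_const (fun _ => by positivity)
  have hlim : ∀ᶠ x in Filter.cocompact ℝ, |g x| < ε / 4 := by
    have := g.zero_at_infty'
    have h2 := (Metric.tendsto_nhds.1 this) (ε / 4) (by positivity)
    simpa [Real.dist_eq] using h2
  obtain ⟨K, hK, hKg⟩ := Filter.mem_cocompact.1 hlim
  obtain ⟨r, hr0, hr⟩ := (hK.isBounded.subset_closedBall_lt 0 (0 : ℝ))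
  let χ : ContDiffBump (0 : ℝ) := ⟨r, r + 1, hr0, by linarith⟩
  let φ : TestFn :=
    { toFun := fun x => χ x * h x
      contDiff' := χ.contDiff.mul hh
      hasCompactSupport' := χ.hasCompactSupport.mul_right
      tsupport_subset' := fun _ _ => trivial }
  refine ⟨TestFn.toC0 φ, ⟨φ, rfl⟩, ?_⟩
  refine lt_of_le_of_lt (b := ε / 2) ?_ (by linarith)
  rw [ZeroAtInftyContinuousMap.dist_toBCF_eq_dist.symm]
  refine (BoundedContinuousFunction.dist_le (by positivity)).2 fun x => ?_
  change dist (g x) (χ x * h x) ≤ ε / 2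
  rw [Real.dist_eq]
  have hχ0 : 0 ≤ χ x := χ.nonneg
  have hχ1 : χ x ≤ 1 := χ.le_one
  have h1 : |h x - g x| ≤ ε / 4 := by
    have := (hgh.1 x).le
    simpa [Real.dist_eq, abs_sub_comm] using this
  have h2 : |(1 - χ x) * g x| ≤ ε / 4 := by
    by_cases hx : x ∈ K
    · have h3 : χ x = 1 := χ.one_of_mem_closedBall (hr hx)
      simp only [h3, sub_self, zero_mul, abs_zero]
      positivity
    · have h4 : |g x| < ε / 4 := hKg hx
      rw [abs_mul, abs_of_nonneg (by linarith)]
      nlinarith [abs_nonneg (g x)]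
  have h5 : |χ x * (h x - g x)| ≤ ε / 4 := by
    rw [abs_mul, abs_of_nonneg hχ0]
    nlinarith [abs_nonneg (h x - g x)]
  calc |g x - χ x * h x| = |(1 - χ x) * g x - χ x * (h x - g x)| := by ring_nf
    _ ≤ |(1 - χ x) * g x| + |χ x * (h x - g x)| := abs_sub _ _
    _ ≤ ε / 2 := by linarith

/-- The distributional second derivative of `f ∈ BV⁽²⁾(ℝ)` extends uniquely to a bounded Radon
measure, that is, to an element of `𝓜(ℝ) = C₀(ℝ)'`. -/
theorem existsUnique_weakD2 (f : BV2) :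
    ∃! w : StrongDual ℝ C₀(ℝ, ℝ), ∀ φ : TestFn, w (TestFn.toC0 φ) = d2Pairing f φ := by
  have hinj : Function.Injective TestFn.toC0 := fun φ ψ h => by
    ext t
    simpa using DFunLike.congr_fun h t
  let l : TestFn →ₗ[ℝ] ℝ :=
    { toFun := d2Pairing f
      map_add' := d2Pairing_add_right f.2.1
      map_smul' := d2Pairing_smul_right f }
  let e := LinearEquiv.ofInjective TestFn.toC0 hinj
  have he : ∀ φ : TestFn, e.symm ⟨TestFn.toC0 φ, φ, rfl⟩ = φ := fun φ => by
    rw [LinearEquiv.symm_apply_eq]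
    rfl
  have hb : ∀ v : LinearMap.range TestFn.toC0,
      ‖(l ∘ₗ e.symm.toLinearMap) v‖ ≤ (TV2 f).toReal * ‖v‖ := by
    rintro ⟨_, φ, rfl⟩
    change |d2Pairing f (e.symm ⟨TestFn.toC0 φ, φ, rfl⟩)| ≤ _
    rw [he]
    exact abs_d2Pairing_le f.2.2 φ
  let u : StrongDual ℝ (LinearMap.range TestFn.toC0) :=
    LinearMap.mkContinuous (σ := RingHom.id ℝ) (E := LinearMap.range TestFn.toC0) (F := ℝ)
      (l ∘ₗ e.symm.toLinearMap) (TV2 f).toReal hb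
  obtain ⟨w, hw, -⟩ := exists_extension_norm_eq (LinearMap.range TestFn.toC0) u
  have hw' : ∀ φ : TestFn, w (TestFn.toC0 φ) = d2Pairing f φ := fun φ => by
    have h1 := hw ⟨TestFn.toC0 φ, φ, rfl⟩
    have h2 : u ⟨TestFn.toC0 φ, φ, rfl⟩ = d2Pairing f (e.symm ⟨TestFn.toC0 φ, φ, rfl⟩) := rfl
    rw [h2, he] at h1
    exact h1
  refine ⟨w, hw', fun w' h' => ?_⟩
  refine DFunLike.coe_injective (TestFn.denseRange_toC0.equalizer w'.continuous w.continuous ?_)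
  funext φ
  exact (h' φ).trans (hw' φ).symm

/-- The second derivative `D² f ∈ 𝓜(ℝ) = C₀(ℝ)'` of `f ∈ BV⁽²⁾(ℝ)`. -/
noncomputable def weakD2 (f : BV2) : StrongDual ℝ C₀(ℝ, ℝ) :=
  (existsUnique_weakD2 f).choose

/-- The weak-* topology of `BV⁽²⁾(ℝ)`. The linear bijection `f ↦ (D² f, f 0, f 1)` identifies
`BV⁽²⁾(ℝ)`, with the norm `TV⁽²⁾(f) + |f 0| + |f 1|`, with `𝓜(ℝ) × ℝ × ℝ`, which is the dual of
the Banach space `C₀(ℝ) × ℝ × ℝ`; the topology is the weak-* topology of this dual. -/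
@[reducible] noncomputable def BV2.weakStar : TopologicalSpace BV2 :=
  TopologicalSpace.induced
    (fun f => ((StrongDual.toWeakDual (weakD2 f) : WeakDual ℝ C₀(ℝ, ℝ)),
      (f : ℝ → ℝ) 0, (f : ℝ → ℝ) 1)) inferInstance

/-- Compactness for the weak-* topology of `BV⁽²⁾(ℝ)`. -/
def IsWeakStarCompact (V : Set BV2) : Prop :=
  @IsCompact BV2 BV2.weakStar V

/-- The Lipschitz constant `L(f) = sup_{x₁ ≠ x₂} |f x₁ - f x₂| / |x₁ - x₂| ∈ [0, ∞]`. -/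
noncomputable def lipConst (f : ℝ → ℝ) : ℝ≥0∞ :=
  ⨆ (x₁ : ℝ) (x₂ : ℝ) (_ : x₁ ≠ x₂), ENNReal.ofReal (|f x₁ - f x₂| / |x₁ - x₂|)

/-- The objective `∑ₘ E(f(xₘ), yₘ) + lam · TV⁽²⁾(f)` on `BV⁽²⁾(ℝ)`. -/
noncomputable def hybridCost {M : ℕ} (E : ℝ → ℝ → ℝ) (x y : Fin M → ℝ) (lam : ℝ) (f : BV2) : ℝ :=
  ∑ m, E ((f : ℝ → ℝ) (x m)) (y m) + lam * (TV2 f).toReal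

/-- The solution set of the Lipschitz-constrained problem: minimizers of the objective over
all `f ∈ BV⁽²⁾(ℝ)` with `L(f) ≤ Lbar`. -/
def hybridSolutions {M : ℕ} (E : ℝ → ℝ → ℝ) (x y : Fin M → ℝ) (lam Lbar : ℝ) : Set BV2 :=
  {f | lipConst f ≤ ENNReal.ofReal Lbar ∧
    ∀ g : BV2, lipConst g ≤ ENNReal.ofReal Lbar →
      hybridCost E x y lam f ≤ hybridCost E x y lam g}

/-- The `TV⁽²⁾`-minimal interpolants of the points `(xₘ, zₘ)` in `BV⁽²⁾(ℝ)`. -/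
def tv2Interpolants {M : ℕ} (x z : Fin M → ℝ) : Set BV2 :=
  {f | (∀ m, (f : ℝ → ℝ) (x m) = z m) ∧
    ∀ g : BV2, (∀ m, (g : ℝ → ℝ) (x m) = z m) → TV2 f ≤ TV2 g}

/-- `f` is a linear spline with at most `N` linear regions: it is continuous, and there is a finite
set `T` of knots, cutting the line into `|T| + 1 ≤ N` intervals, such that `f` is affine on every
interval that contains no knot. -/
def IsLinearSpline (f : ℝ → ℝ) (N : ℕ) : Prop :=
  Continuous f ∧ ∃ T : Finset ℝ, T.card + 1 ≤ N ∧
    ∀ I : Set ℝ, I.OrdConnected → Disjoint I (T : Set ℝ) →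
      ∃ a b : ℝ, ∀ t ∈ I, f t = a * t + b

/-- The sum of absolute slope differences
`∑_{m=2}^{M-1} |(zₘ - zₘ₋₁)/(xₘ - xₘ₋₁) - (zₘ - zₘ₊₁)/(xₘ - xₘ₊₁)|`. Here `xₘ` is `x (m - 1)`,
and the summation index is `i = m - 2`. -/
noncomputable def slopeVariation {M : ℕ} (x z : Fin M → ℝ) : ℝ :=
  ∑ i : Fin (M - 2),
    let p : Fin M := ⟨i, by omega⟩
    let c : Fin M := ⟨i + 1, by omega⟩
    let n : Fin M := ⟨i + 2, by omega⟩
    |(z c - z p) / (x c - x p) - (z c - z n) / (x c - x n)|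

/-! ### The second derivative as a functional -/

theorem weakD2_toC0 (f : BV2) (φ : TestFn) :
    weakD2 f (TestFn.toC0 φ) = d2Pairing f φ :=
  (existsUnique_weakD2 f).choose_spec.1 φ

theorem weakD2_eq_of_forall {f : BV2} {w : StrongDual ℝ C₀(ℝ, ℝ)}
    (h : ∀ φ : TestFn, w (TestFn.toC0 φ) = d2Pairing f φ) : weakD2 f = w :=
  (existsUnique_weakD2 f).unique (weakD2_toC0 f) h

theorem weakD2_add (f g : BV2) : weakD2 (f + g) = weakD2 f + weakD2 g :=
  weakD2_eq_of_forall fun φ => by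
    rw [add_apply, weakD2_toC0, weakD2_toC0]
    exact (d2Pairing_add_left f.2.1 g.2.1 φ).symm

theorem weakD2_smul (c : ℝ) (f : BV2) : weakD2 (c • f) = c • weakD2 f :=
  weakD2_eq_of_forall fun φ => by
    rw [smul_apply, weakD2_toC0]
    exact (d2Pairing_smul_left c f φ).symm

theorem norm_weakD2_le (f : BV2) : ‖weakD2 f‖ ≤ (TV2 f).toReal := by
  refine ContinuousLinearMap.opNorm_le_bound _ ENNReal.toReal_nonneg fun g => ?_
  refine TestFn.denseRange_toC0.induction_on (p := fun g => ‖weakD2 f g‖ ≤ (TV2 f).toReal * ‖g‖) g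
    ?_ fun φ => ?_
  · exact isClosed_le (by fun_prop) (by fun_prop)
  · rw [weakD2_toC0]
    exact abs_d2Pairing_le f.2.2 φ

theorem TV2_le_of_forall {f : ℝ → ℝ} {w : StrongDual ℝ C₀(ℝ, ℝ)}
    (h : ∀ φ : TestFn, w (TestFn.toC0 φ) = d2Pairing f φ) : TV2 f ≤ ENNReal.ofReal ‖w‖ := by
  refine iSup₂_le fun φ hφ => ENNReal.ofReal_le_ofReal ?_
  rw [← h]
  simpa [hφ] using (le_abs_self _).trans (w.le_opNorm (TestFn.toC0 φ))

theorem TV2_eq_norm (f : BV2) : TV2 f = ENNReal.ofReal ‖weakD2 f‖ :=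
  le_antisymm (TV2_le_of_forall (weakD2_toC0 f)) <| by
    rw [← ENNReal.ofReal_toReal f.2.2.ne]
    exact ENNReal.ofReal_le_ofReal (norm_weakD2_le f)

theorem toReal_TV2 (f : BV2) : (TV2 f).toReal = ‖weakD2 f‖ := by
  rw [TV2_eq_norm, ENNReal.toReal_ofReal (norm_nonneg (weakD2 f))]

theorem TV2_le_TV2_iff (f g : BV2) : TV2 f ≤ TV2 g ↔ ‖weakD2 f‖ ≤ ‖weakD2 g‖ := by
  rw [TV2_eq_norm, TV2_eq_norm, ENNReal.ofReal_le_ofReal_iff (norm_nonneg (weakD2 g))]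

/-! ### Integrals against the second derivative of a test function -/

theorem TestFn.iteratedDeriv_two (φ : TestFn) :
    iteratedDeriv 2 (φ : ℝ → ℝ) = deriv (deriv φ) := by
  rw [iteratedDeriv_succ, iteratedDeriv_one]

theorem TestFn.contDiff_deriv (φ : TestFn) : ContDiff ℝ (⊤ : ℕ∞) (deriv (φ : ℝ → ℝ)) :=
  (contDiff_infty_iff_deriv.1 φ.contDiff').2

theorem TestFn.deriv_sub_mul_deriv (φ : TestFn) (t : ℝ) :
    deriv (fun x => (x - t) * deriv φ x - φ x) = fun x => (x - t) * iteratedDeriv 2 φ x := by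
  funext x
  have h1 : HasDerivAt φ (deriv φ x) x :=
    (φ.contDiff'.differentiable (by simp)).differentiableAt.hasDerivAt
  have h2 : HasDerivAt (deriv φ) (deriv (deriv φ) x) x :=
    (φ.contDiff_deriv.differentiable (by simp)).differentiableAt.hasDerivAt
  have h3 := (((hasDerivAt_id x).sub_const t).mul h2).sub h1
  rw [φ.iteratedDeriv_two]
  refine (h3.congr_deriv ?_).deriv
  simp

theorem TestFn.contDiff_sub_mul_deriv (φ : TestFn) (t : ℝ) :
    ContDiff ℝ 1 (fun x => (x - t) * deriv φ x - φ x) :=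
  ((((contDiff_id.sub contDiff_const).mul φ.contDiff_deriv).sub φ.contDiff').of_le
    (by exact_mod_cast le_top))

theorem TestFn.hasCompactSupport_sub_mul_deriv (φ : TestFn) (t : ℝ) :
    HasCompactSupport (fun x => (x - t) * deriv φ x - φ x) :=
  (φ.hasCompactSupport'.deriv.mul_left (f := fun x => x - t)).sub φ.hasCompactSupport'

theorem integral_ramp_mul_d2 (φ : TestFn) (t : ℝ) :
    ∫ x, max (x - t) 0 * iteratedDeriv 2 φ x = φ t := by
  have h : (fun x => max (x - t) 0 * iteratedDeriv 2 φ x)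
      = (Set.Ioi t).indicator (fun x => (x - t) * iteratedDeriv 2 φ x) := by
    funext x
    by_cases hx : t < x
    · rw [Set.indicator_of_mem (by exact hx), max_eq_left (by linarith)]
    · rw [Set.indicator_of_notMem (by exact hx), max_eq_right (by linarith), zero_mul]
  rw [h, MeasureTheory.integral_indicator measurableSet_Ioi, ← φ.deriv_sub_mul_deriv t,
    HasCompactSupport.integral_Ioi_deriv_eq (φ.contDiff_sub_mul_deriv t)
      (φ.hasCompactSupport_sub_mul_deriv t)]
  simp

theorem integral_sub_mul_d2 (φ : TestFn) (t : ℝ) :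
    ∫ x, (x - t) * iteratedDeriv 2 φ x = 0 := by
  have hi : MeasureTheory.Integrable (fun x => (x - t) * iteratedDeriv 2 φ x) :=
    integrable_mul_d2 (f := fun x => x - t) (by fun_prop) φ
  rw [← intervalIntegral.integral_Iic_add_Ioi (b := t) hi.integrableOn hi.integrableOn,
    ← φ.deriv_sub_mul_deriv t,
    HasCompactSupport.integral_Ioi_deriv_eq (φ.contDiff_sub_mul_deriv t)
      (φ.hasCompactSupport_sub_mul_deriv t),
    HasCompactSupport.integral_Iic_deriv_eq (φ.contDiff_sub_mul_deriv t)
      (φ.hasCompactSupport_sub_mul_deriv t)]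
  ring

theorem d2Pairing_affine (a b : ℝ) (φ : TestFn) : d2Pairing (fun x => a * x + b) φ = 0 := by
  have h : (fun x : ℝ => a * x + b)
      = (a + b) • (fun x : ℝ => x - 0) + (-b) • (fun x : ℝ => x - 1) := by
    funext x
    simp
    ring
  rw [h, d2Pairing_add_left (by fun_prop) (by fun_prop), d2Pairing_smul_left, d2Pairing_smul_left,
    d2Pairing, d2Pairing, integral_sub_mul_d2, integral_sub_mul_d2]
  simp

/-! ### The kernel of interpolation with remainder -/

/-- The Peano kernel of the remainder, at `x`, of linear interpolation at the nodes `p` and `q`. -/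
noncomputable def peanoKernel (p q x t : ℝ) : ℝ :=
  max (x - t) 0 - (q - x) / (q - p) * max (p - t) 0 - (x - p) / (q - p) * max (q - t) 0

theorem continuous_peanoKernel (p q x : ℝ) : Continuous (peanoKernel p q x) := by
  unfold peanoKernel
  fun_prop

theorem peanoKernel_of_le {p q x t : ℝ} (hpq : p < q) (h1 : t ≤ p) (h2 : t ≤ x) :
    peanoKernel p q x t = 0 := by
  have : q - p ≠ 0 := by linarith
  rw [peanoKernel, max_eq_left (by linarith), max_eq_left (by linarith),
    max_eq_left (by linarith)]
  field_simp
  ring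

theorem peanoKernel_of_ge {p q x t : ℝ} (hpq : p < q) (h1 : q ≤ t) (h2 : x ≤ t) :
    peanoKernel p q x t = 0 := by
  rw [peanoKernel, max_eq_right (by linarith), max_eq_right (by linarith),
    max_eq_right (by linarith)]
  ring

theorem hasCompactSupport_peanoKernel {p q : ℝ} (hpq : p < q) (x : ℝ) :
    HasCompactSupport (peanoKernel p q x) := by
  refine HasCompactSupport.intro (isCompact_Icc (a := min p x) (b := max q x)) fun t ht => ?_
  rw [Set.mem_Icc, not_and_or, not_le, not_le, lt_min_iff, max_lt_iff] at ht
  rcases ht with h | h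
  · exact peanoKernel_of_le hpq h.1.le h.2.le
  · exact peanoKernel_of_ge hpq h.1.le h.2.le

/-- The Peano kernel as an element of `C₀(ℝ)`. -/
noncomputable def peanoC0 {p q : ℝ} (hpq : p < q) (x : ℝ) : C₀(ℝ, ℝ) where
  toFun := peanoKernel p q x
  continuous_toFun := continuous_peanoKernel p q x
  zero_at_infty' := (hasCompactSupport_peanoKernel hpq x).is_zero_at_infty

@[simp] theorem peanoC0_apply {p q : ℝ} (hpq : p < q) (x t : ℝ) :
    peanoC0 hpq x t = peanoKernel p q x t := rfl

theorem C0.norm_le {g : C₀(ℝ, ℝ)} {C : ℝ} (hC : 0 ≤ C) (h : ∀ t, |g t| ≤ C) : ‖g‖ ≤ C := by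
  rw [← ZeroAtInftyContinuousMap.norm_toBCF_eq_norm]
  exact (BoundedContinuousFunction.norm_le hC).2 h

theorem C0.abs_apply_le (g : C₀(ℝ, ℝ)) (t : ℝ) : |g t| ≤ ‖g‖ := by
  rw [← ZeroAtInftyContinuousMap.norm_toBCF_eq_norm]
  exact g.toBCF.norm_coe_le_norm t

/-- Evaluation at a point, as a functional on `C₀(ℝ)`. -/
noncomputable def C0.dirac (t : ℝ) : StrongDual ℝ C₀(ℝ, ℝ) :=
  LinearMap.mkContinuous (σ := RingHom.id ℝ) (E := C₀(ℝ, ℝ)) (F := ℝ)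
    { toFun := fun g => g t
      map_add' := fun _ _ => rfl
      map_smul' := fun _ _ => rfl } 1 fun g => by
    rw [one_mul]
    exact C0.abs_apply_le g t

@[simp] theorem C0.dirac_apply (t : ℝ) (g : C₀(ℝ, ℝ)) : C0.dirac t g = g t := rfl

theorem norm_peanoC0_sub_le {p q : ℝ} (hpq : p < q) (x y : ℝ) :
    ‖peanoC0 hpq x - peanoC0 hpq y‖ ≤ 2 * |x - y| := by
  refine C0.norm_le (by positivity) fun t => ?_
  have hd : 0 < q - p := by linarith
  have e : (peanoC0 hpq x - peanoC0 hpq y) t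
      = (max (x - t) 0 - max (y - t) 0)
        + (x - y) * ((max (p - t) 0 - max (q - t) 0) / (q - p)) := by
    simp only [ZeroAtInftyContinuousMap.sub_apply, peanoC0_apply, peanoKernel]
    field_simp
    ring
  have h1 : |max (x - t) 0 - max (y - t) 0| ≤ |x - y| := by
    simpa using abs_max_sub_max_le_abs (x - t) (y - t) 0
  have h2 : |(max (p - t) 0 - max (q - t) 0) / (q - p)| ≤ 1 := by
    rw [abs_div, abs_of_pos hd, div_le_one hd]
    have := abs_max_sub_max_le_abs (p - t) (q - t) 0
    rw [sub_sub_sub_cancel_right, abs_sub_comm p q, abs_of_pos hd] at this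
    exact this
  rw [e]
  refine (abs_add_le _ _).trans ?_
  rw [abs_mul]
  nlinarith [abs_nonneg (x - y)]

theorem continuous_peanoC0 {p q : ℝ} (hpq : p < q) : Continuous (peanoC0 hpq) := by
  refine (LipschitzWith.of_dist_le_mul (K := 2) fun x y => ?_).continuous
  rw [dist_eq_norm, Real.dist_eq]
  exact norm_peanoC0_sub_le hpq x y

theorem integral_peanoKernel_mul_d2 (p q : ℝ) (φ : TestFn) (t : ℝ) :
    ∫ x, peanoKernel p q x t * iteratedDeriv 2 φ x = φ t := by
  have e : (fun x => peanoKernel p q x t) = (fun x => max (x - t) 0)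
      + fun x => ((max (p - t) 0 - max (q - t) 0) / (q - p)) * x
          + (p * max (q - t) 0 - q * max (p - t) 0) / (q - p) := by
    funext x
    simp only [peanoKernel, Pi.add_apply]
    ring
  have h := d2Pairing_add_left (f := fun x => max (x - t) 0)
    (g := fun x => ((max (p - t) 0 - max (q - t) 0) / (q - p)) * x
          + (p * max (q - t) 0 - q * max (p - t) 0) / (q - p)) (by fun_prop) (by fun_prop) φ
  rw [← e, d2Pairing_affine, add_zero] at h
  exact h.trans (integral_ramp_mul_d2 φ t)

theorem integral_d2_smul_peanoC0 {p q : ℝ} (hpq : p < q) (φ : TestFn) :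
    MeasureTheory.Integrable (fun x => iteratedDeriv 2 φ x • peanoC0 hpq x) ∧
    ∫ x, iteratedDeriv 2 φ x • peanoC0 hpq x = TestFn.toC0 φ := by
  have hi : MeasureTheory.Integrable (fun x => iteratedDeriv 2 φ x • peanoC0 hpq x) :=
    (φ.continuous_d2.smul (continuous_peanoC0 hpq)).integrable_of_hasCompactSupport
      φ.hasCompactSupport_d2.smul_right
  refine ⟨hi, ?_⟩
  ext t
  rw [← C0.dirac_apply, ← (C0.dirac t).integral_comp_comm hi]
  rw [TestFn.toC0_apply, ← integral_peanoKernel_mul_d2 p q φ t]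
  congr 1
  funext x
  simp [mul_comm]

/-! ### Functions with a prescribed second derivative -/

/-- The function with second derivative `w` and values `A` at `p`, `B` at `q`. -/
noncomputable def d2Inverse {p q : ℝ} (hpq : p < q) (A B : ℝ) (w : StrongDual ℝ C₀(ℝ, ℝ))
    (x : ℝ) : ℝ :=
  A * ((q - x) / (q - p)) + B * ((x - p) / (q - p)) + w (peanoC0 hpq x)

theorem continuous_d2Inverse {p q : ℝ} (hpq : p < q) (A B : ℝ) (w : StrongDual ℝ C₀(ℝ, ℝ)) :
    Continuous (d2Inverse hpq A B w) := by
  unfold d2Inverse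
  have := w.continuous.comp (continuous_peanoC0 hpq)
  exact (by fun_prop : Continuous fun x => A * ((q - x) / (q - p)) + B * ((x - p) / (q - p))).add
    this

theorem d2Pairing_d2Inverse {p q : ℝ} (hpq : p < q) (A B : ℝ) (w : StrongDual ℝ C₀(ℝ, ℝ))
    (φ : TestFn) : w (TestFn.toC0 φ) = d2Pairing (d2Inverse hpq A B w) φ := by
  have e : d2Inverse hpq A B w = (fun x => w (peanoC0 hpq x))
      + fun x => ((B - A) / (q - p)) * x + (A * q - B * p) / (q - p) := by
    funext x
    simp only [d2Inverse, Pi.add_apply]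
    ring
  have hc : Continuous fun x => w (peanoC0 hpq x) := w.continuous.comp (continuous_peanoC0 hpq)
  obtain ⟨hi, h⟩ := integral_d2_smul_peanoC0 hpq φ
  rw [e, d2Pairing_add_left hc (by fun_prop), d2Pairing_affine, add_zero, ← h,
    ← w.integral_comp_comm hi, d2Pairing]
  congr 1
  funext x
  simp [mul_comm]

theorem d2Inverse_mem_BV2 {p q : ℝ} (hpq : p < q) (A B : ℝ) (w : StrongDual ℝ C₀(ℝ, ℝ)) :
    d2Inverse hpq A B w ∈ BV2 :=
  ⟨continuous_d2Inverse hpq A B w,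
    (TV2_le_of_forall (d2Pairing_d2Inverse hpq A B w)).trans_lt ENNReal.ofReal_lt_top⟩

/-- `d2Inverse` as an element of `BV⁽²⁾(ℝ)`. -/
noncomputable def BV2.ofD2 {p q : ℝ} (hpq : p < q) (A B : ℝ) (w : StrongDual ℝ C₀(ℝ, ℝ)) : BV2 :=
  ⟨d2Inverse hpq A B w, d2Inverse_mem_BV2 hpq A B w⟩

theorem BV2.ofD2_apply {p q : ℝ} (hpq : p < q) (A B : ℝ) (w : StrongDual ℝ C₀(ℝ, ℝ)) (x : ℝ) :
    (BV2.ofD2 hpq A B w : ℝ → ℝ) x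
      = A * ((q - x) / (q - p)) + B * ((x - p) / (q - p)) + w (peanoC0 hpq x) := rfl

theorem weakD2_ofD2 {p q : ℝ} (hpq : p < q) (A B : ℝ) (w : StrongDual ℝ C₀(ℝ, ℝ)) :
    weakD2 (BV2.ofD2 hpq A B w) = w :=
  weakD2_eq_of_forall (d2Pairing_d2Inverse hpq A B w)

theorem peanoC0_left {p q : ℝ} (hpq : p < q) : peanoC0 hpq p = 0 := by
  ext t
  have : q - p ≠ 0 := by linarith
  simp [peanoKernel, div_self this]

theorem peanoC0_right {p q : ℝ} (hpq : p < q) : peanoC0 hpq q = 0 := by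
  ext t
  have : q - p ≠ 0 := by linarith
  simp [peanoKernel, div_self this]

theorem BV2.ofD2_left {p q : ℝ} (hpq : p < q) (A B : ℝ) (w : StrongDual ℝ C₀(ℝ, ℝ)) :
    (BV2.ofD2 hpq A B w : ℝ → ℝ) p = A := by
  have : q - p ≠ 0 := by linarith
  simp [BV2.ofD2_apply, peanoC0_left, div_self this]

theorem BV2.ofD2_right {p q : ℝ} (hpq : p < q) (A B : ℝ) (w : StrongDual ℝ C₀(ℝ, ℝ)) :
    (BV2.ofD2 hpq A B w : ℝ → ℝ) q = B := by
  have : q - p ≠ 0 := by linarith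
  simp [BV2.ofD2_apply, peanoC0_right, div_self this]

/-! ### Every function of `BV⁽²⁾(ℝ)` is recovered from its second derivative -/

open MeasureTheory in
open scoped Convolution in
theorem convolution_normed_affine {f : ℝ → ℝ} (hf : Continuous f)
    (h : ∀ φ : TestFn, d2Pairing f φ = 0) (b : ContDiffBump (0 : ℝ)) :
    ∃ a c : ℝ, ∀ x, (b.normed volume ⋆[ContinuousLinearMap.lsmul ℝ ℝ, volume] f) x = a * x + c := by
  set ρ : ℝ → ℝ := b.normed volume with hρ
  have hc : HasCompactSupport ρ := b.hasCompactSupport_normed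
  have hs : ContDiff ℝ (⊤ : ℕ∞) ρ := b.contDiff_normed
  have hs' : ContDiff ℝ (⊤ : ℕ∞) (deriv ρ) := (contDiff_infty_iff_deriv.1 hs).2
  have h1 := fun x => hc.hasDerivAt_convolution_left (ContinuousLinearMap.lsmul ℝ ℝ) (μ := volume)
    (hs.of_le (by exact_mod_cast le_top)) hf.locallyIntegrable x
  have h2 := fun x => hc.deriv.hasDerivAt_convolution_left (ContinuousLinearMap.lsmul ℝ ℝ)
    (μ := volume) (hs'.of_le (by exact_mod_cast le_top)) hf.locallyIntegrable x
  have h3 : ∀ x, (deriv (deriv ρ) ⋆[ContinuousLinearMap.lsmul ℝ ℝ, volume] f) x = 0 := by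
    intro x
    let φ : TestFn :=
      { toFun := fun t => ρ (x - t)
        contDiff' := hs.comp (contDiff_const.sub contDiff_id)
        hasCompactSupport' := hc.comp_homeomorph (Homeomorph.subLeft x)
        tsupport_subset' := fun _ _ => trivial }
    rw [convolution_eq_swap]
    refine Eq.trans ?_ (h φ)
    rw [d2Pairing]
    congr 1
    funext t
    have : iteratedDeriv 2 (φ : ℝ → ℝ) t = deriv (deriv ρ) (x - t) := by
      change iteratedDeriv 2 (fun t => ρ (x - t)) t = _
      rw [iteratedDeriv_comp_const_sub, iteratedDeriv_succ, iteratedDeriv_one]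
      simp
    rw [this]
    simp [mul_comm]
  set g := (ρ ⋆[ContinuousLinearMap.lsmul ℝ ℝ, volume] f)
  set g' := (deriv ρ ⋆[ContinuousLinearMap.lsmul ℝ ℝ, volume] f)
  have h4 : ∀ x, g' x = g' 0 := fun x =>
    is_const_of_deriv_eq_zero (fun y => (h2 y).differentiableAt)
      (fun y => (h2 y).deriv.trans (h3 y)) x 0
  have h5 : ∀ x, HasDerivAt (fun x => g x - g' 0 * x) 0 x := fun x => by
    have := (h1 x).sub ((hasDerivAt_id x).const_mul (g' 0))
    refine this.congr_deriv ?_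
    simp [h4 x]
  refine ⟨g' 0, g 0, fun x => ?_⟩
  have := is_const_of_deriv_eq_zero (fun y => (h5 y).differentiableAt) (fun y => (h5 y).deriv) x 0
  simp only [mul_zero, sub_zero] at this
  linarith

theorem eq_line_of_d2Pairing_eq_zero {f : ℝ → ℝ} (hf : Continuous f)
    (h : ∀ φ : TestFn, d2Pairing f φ = 0) (p q x : ℝ) :
    f x * (q - p) = f p * (q - x) + f q * (x - p) := by
  let b : ℕ → ContDiffBump (0 : ℝ) := fun n =>
    ⟨1 / (n + 1) / 2, 1 / (n + 1), by positivity, by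
      have : (0 : ℝ) < 1 / (n + 1) := by positivity
      linarith⟩
  have hb : Filter.Tendsto (fun n => (b n).rOut) Filter.atTop (𝓝 0) :=
    tendsto_one_div_add_atTop_nhds_zero_nat
  have hlim := ContDiffBump.convolution_tendsto_right_of_continuous (μ := MeasureTheory.volume) hb hf
  refine tendsto_nhds_unique ((hlim x).mul_const (q - p)) (Filter.Tendsto.congr (fun n => ?_)
    (((hlim p).mul_const (q - x)).add ((hlim q).mul_const (x - p))))
  obtain ⟨a, c, hac⟩ := convolution_normed_affine hf h (b n)
  simp only [hac]
  ring

/-- Linear interpolation at `p` and `q` with Peano remainder. -/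
theorem BV2.apply_eq {p q : ℝ} (hpq : p < q) (f : BV2) (x : ℝ) :
    (f : ℝ → ℝ) x = (f : ℝ → ℝ) p * ((q - x) / (q - p)) + (f : ℝ → ℝ) q * ((x - p) / (q - p))
      + weakD2 f (peanoC0 hpq x) := by
  set g := BV2.ofD2 hpq ((f : ℝ → ℝ) p) ((f : ℝ → ℝ) q) (weakD2 f) with hg
  have h0 : weakD2 (f + (-1 : ℝ) • g) = 0 := by
    rw [weakD2_add, weakD2_smul, hg, weakD2_ofD2]
    ext φ
    change weakD2 f φ + -1 * weakD2 f φ = 0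
    ring
  have h1 := eq_line_of_d2Pairing_eq_zero (f + (-1 : ℝ) • g).2.1
    (fun φ => by rw [← weakD2_toC0, h0]; rfl) p q x
  have e : ∀ y, ((f + (-1 : ℝ) • g : BV2) : ℝ → ℝ) y = (f : ℝ → ℝ) y - (g : ℝ → ℝ) y := fun y => by
    simp [sub_eq_add_neg]
  have hd : q - p ≠ 0 := by linarith
  rw [e, e, e, hg, BV2.ofD2_left, BV2.ofD2_right] at h1
  simp only [sub_self, zero_mul, add_zero, mul_eq_zero, hd, or_false] at h1
  rw [BV2.ofD2_apply] at h1
  linarith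

theorem BV2.eq_ofD2 {p q : ℝ} (hpq : p < q) (f : BV2) :
    f = BV2.ofD2 hpq ((f : ℝ → ℝ) p) ((f : ℝ → ℝ) q) (weakD2 f) :=
  Subtype.ext (funext fun x => BV2.apply_eq hpq f x)

/-! ### Hat functions -/

/-- The difference of the slopes of `f` over `[b, c]` and `[a, b]`. -/
noncomputable def slopeDiff (f : ℝ → ℝ) (a b c : ℝ) : ℝ :=
  (f c - f b) / (c - b) - (f b - f a) / (b - a)

/-- The hat function with nodes `a < b < c`. -/
noncomputable def hat {a b c : ℝ} (hab : a < b) (_ : b < c) : C₀(ℝ, ℝ) :=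
  (c - b)⁻¹ • peanoC0 hab c

theorem weakD2_hat (f : BV2) {a b c : ℝ} (hab : a < b) (hbc : b < c) :
    weakD2 f (hat hab hbc) = slopeDiff f a b c := by
  have h := BV2.apply_eq hab f c
  have h1 : b - a ≠ 0 := by linarith
  have h2 : c - b ≠ 0 := by linarith
  rw [hat, map_smul, smul_eq_mul, slopeDiff, inv_mul_eq_div, div_eq_iff h2]
  have h3 : weakD2 f (peanoC0 hab c) = (f : ℝ → ℝ) c - ((f : ℝ → ℝ) a * ((b - c) / (b - a))
    + (f : ℝ → ℝ) b * ((c - a) / (b - a))) := by linarith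
  rw [h3]
  field_simp
  ring

/-- The continuous step that falls linearly from `1` to `0` between `a` and `b`. -/
noncomputable def fallingStep (a b t : ℝ) : ℝ := (max (b - t) 0 - max (a - t) 0) / (b - a)

theorem fallingStep_nonneg {a b : ℝ} (hab : a < b) (t : ℝ) : 0 ≤ fallingStep a b t :=
  div_nonneg (sub_nonneg.2 (max_le_max_right _ (by linarith))) (by linarith)

theorem fallingStep_le_one {a b : ℝ} (hab : a < b) (t : ℝ) : fallingStep a b t ≤ 1 := by
  rw [fallingStep, div_le_one (by linarith), sub_le_iff_le_add]
  exact max_le (by linarith [le_max_left (a - t) 0]) (by linarith [le_max_right (a - t) 0])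

theorem fallingStep_of_ge {a b t : ℝ} (hab : a < b) (h : b ≤ t) : fallingStep a b t = 0 := by
  simp [fallingStep, max_eq_right (sub_nonpos.2 h), max_eq_right (sub_nonpos.2 (hab.le.trans h))]

theorem fallingStep_of_le {a b t : ℝ} (hab : a < b) (h : t ≤ a) : fallingStep a b t = 1 := by
  have : b - a ≠ 0 := by linarith
  simp [fallingStep, max_eq_left (sub_nonneg.2 h), max_eq_left (sub_nonneg.2 (h.trans hab.le)), this]

theorem hat_apply {a b c : ℝ} (hab : a < b) (hbc : b < c) (t : ℝ) :
    hat hab hbc t = fallingStep b c t - fallingStep a b t := by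
  have h1 : b - a ≠ 0 := by linarith
  have h2 : c - b ≠ 0 := by linarith
  simp only [hat, ZeroAtInftyContinuousMap.smul_apply, peanoC0_apply, peanoKernel, fallingStep,
    smul_eq_mul]
  field_simp
  ring

theorem hat_nonneg {a b c : ℝ} (hab : a < b) (hbc : b < c) (t : ℝ) : 0 ≤ hat hab hbc t := by
  rw [hat_apply]
  rcases le_total t b with h | h
  · rw [fallingStep_of_le hbc h]
    linarith [fallingStep_le_one hab t]
  · rw [fallingStep_of_ge hab h]
    linarith [fallingStep_nonneg hbc t]

theorem hat_center {a b c : ℝ} (hab : a < b) (hbc : b < c) : hat hab hbc b = 1 := by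
  rw [hat_apply, fallingStep_of_le hbc le_rfl, fallingStep_of_ge hab le_rfl, sub_zero]

theorem hat_of_le {a b c t : ℝ} (hab : a < b) (hbc : b < c) (h : t ≤ a) : hat hab hbc t = 0 := by
  rw [hat_apply, fallingStep_of_le hbc (h.trans hab.le), fallingStep_of_le hab h, sub_self]

theorem hat_of_ge {a b c t : ℝ} (hab : a < b) (hbc : b < c) (h : c ≤ t) : hat hab hbc t = 0 := by
  rw [hat_apply, fallingStep_of_ge hbc h, fallingStep_of_ge hab (hbc.le.trans h), sub_self]

/-- The hat functions centred at the interior nodes of a strictly increasing sequence. -/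
noncomputable def hatSeq {X : ℕ → ℝ} (hX : StrictMono X) (k : ℕ) : C₀(ℝ, ℝ) :=
  hat (hX k.lt_succ_self) (hX (k + 1).lt_succ_self)

theorem hatSeq_nonneg {X : ℕ → ℝ} (hX : StrictMono X) (k : ℕ) (t : ℝ) : 0 ≤ hatSeq hX k t :=
  hat_nonneg _ _ t

theorem sum_hatSeq_apply {X : ℕ → ℝ} (hX : StrictMono X) (N : ℕ) (t : ℝ) :
    ∑ k ∈ Finset.range N, hatSeq hX k t
      = fallingStep (X N) (X (N + 1)) t - fallingStep (X 0) (X 1) t := by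
  simp only [hatSeq, hat_apply]
  exact Finset.sum_range_sub (fun k => fallingStep (X k) (X (k + 1)) t) N

theorem sum_hatSeq_le_one {X : ℕ → ℝ} (hX : StrictMono X) (N : ℕ) (t : ℝ) :
    ∑ k ∈ Finset.range N, hatSeq hX k t ≤ 1 := by
  rw [sum_hatSeq_apply]
  linarith [fallingStep_nonneg (hX Nat.zero_lt_one) t, fallingStep_le_one (hX N.lt_succ_self) t]

theorem C0.sum_apply {ι : Type*} (s : Finset ι) (h : ι → C₀(ℝ, ℝ)) (t : ℝ) :
    (∑ i ∈ s, h i) t = ∑ i ∈ s, h i t := by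
  simp only [← C0.dirac_apply, map_sum]

/-- Nonnegative functions with sum at most `1`, combined with signs, test the norm of `w`. -/
theorem sum_abs_le_norm {ι : Type*} (w : StrongDual ℝ C₀(ℝ, ℝ)) (s : Finset ι) (h : ι → C₀(ℝ, ℝ))
    (h0 : ∀ i ∈ s, ∀ t, 0 ≤ h i t) (h1 : ∀ t, ∑ i ∈ s, h i t ≤ 1) :
    ∃ η : C₀(ℝ, ℝ), (∃ ε : ι → ℝ, η = ∑ i ∈ s, ε i • h i) ∧ (∀ t, |η t| ≤ 1) ∧
      w η = ∑ i ∈ s, |w (h i)| := by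
  refine ⟨∑ i ∈ s, (SignType.sign (w (h i)) : ℝ) • h i, ⟨_, rfl⟩, fun t => ?_, ?_⟩
  · rw [C0.sum_apply]
    refine (Finset.abs_sum_le_sum_abs _ _).trans ((Finset.sum_le_sum fun i hi => ?_).trans (h1 t))
    rw [ZeroAtInftyContinuousMap.smul_apply, smul_eq_mul, abs_mul, abs_of_nonneg (h0 i hi t)]
    refine mul_le_of_le_one_left (h0 i hi t) ?_
    rcases lt_trichotomy (w (h i)) 0 with h | h | h <;> simp [h]
  · rw [map_sum]
    refine Finset.sum_congr rfl fun i _ => ?_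
    rw [map_smul, smul_eq_mul, sign_mul_self]

theorem apply_le_norm {w : StrongDual ℝ C₀(ℝ, ℝ)} {η : C₀(ℝ, ℝ)} (h : ∀ t, |η t| ≤ 1) :
    w η ≤ ‖w‖ :=
  (le_abs_self _).trans ((w.le_opNorm η).trans
    (mul_le_of_le_one_right (norm_nonneg w) (C0.norm_le zero_le_one h)))

theorem sum_abs_hatSeq_le_norm (w : StrongDual ℝ C₀(ℝ, ℝ)) {X : ℕ → ℝ} (hX : StrictMono X) (N : ℕ) :
    ∑ k ∈ Finset.range N, |w (hatSeq hX k)| ≤ ‖w‖ := by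
  obtain ⟨η, -, h1, h2⟩ := sum_abs_le_norm w (Finset.range N) (hatSeq hX)
    (fun i _ t => hatSeq_nonneg hX i t) (sum_hatSeq_le_one hX N)
  rw [← h2]
  exact apply_le_norm h1

/-- If the norm of `w` is attained by the hat functions of a sequence, then replacing some of them
by other functions does not increase the sum of the absolute values of `w`. -/
theorem sum_abs_le_of_exchange {w : StrongDual ℝ C₀(ℝ, ℝ)} {X : ℕ → ℝ} (hX : StrictMono X) {N : ℕ}
    (hw : ‖w‖ ≤ ∑ k ∈ Finset.range N, |w (hatSeq hX k)|) {s : Finset ℕ} (hs : s ⊆ Finset.range N)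
    {r : ℕ} (g : Fin r → C₀(ℝ, ℝ)) (g0 : ∀ j t, 0 ≤ g j t)
    (h1 : ∀ t, ∑ j, g j t + ∑ k ∈ Finset.range N \ s, hatSeq hX k t ≤ 1) :
    ∑ j, |w (g j)| ≤ ∑ k ∈ s, |w (hatSeq hX k)| := by
  obtain ⟨η, -, h2, h3⟩ := sum_abs_le_norm w (Finset.univ.disjSum (Finset.range N \ s))
    (Sum.elim g (hatSeq hX)) (by
      rintro (i | i) _ t
      · exact g0 i t
      · exact hatSeq_nonneg hX i t) (by
      intro t
      rw [Finset.sum_disjSum]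
      exact h1 t)
  rw [Finset.sum_disjSum] at h3
  simp only [Sum.elim_inl, Sum.elim_inr] at h3
  have h4 := Finset.sum_sdiff hs (f := fun k => |w (hatSeq hX k)|)
  have h5 := apply_le_norm (w := w) h2
  linarith

/-! ### Minimal interpolants inherit the Lipschitz bound of the data -/

theorem middle_slope_le {s₀ s₁ s₂ σ₁ σ₂ σ₃ α β γ L : ℝ} (hα : 0 < α) (hβ : 0 < β) (hγ : 0 < γ)
    (hmean : α * σ₁ + β * σ₂ + γ * σ₃ = (α + β + γ) * s₁)
    (h : |σ₁ - s₀| + |σ₂ - σ₁| + |σ₃ - σ₂| + |s₂ - σ₃| ≤ |s₁ - s₀| + |s₂ - s₁|)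
    (h₀ : s₀ ≤ L) (h₁ : s₁ ≤ L) (h₂ : s₂ ≤ L) : σ₂ ≤ L := by
  by_contra! hL
  have a1 := le_abs_self (σ₁ - s₀)
  have a1' := neg_abs_le (σ₁ - s₀)
  have a2 := le_abs_self (σ₂ - σ₁)
  have a2' := neg_abs_le (σ₂ - σ₁)
  have a3 := le_abs_self (σ₃ - σ₂)
  have a3' := neg_abs_le (σ₃ - σ₂)
  have a4 := le_abs_self (s₂ - σ₃)
  have a4' := neg_abs_le (s₂ - σ₃)
  have hlt : σ₁ < s₁ ∨ σ₃ < s₁ := by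
    by_contra! hc
    nlinarith [mul_nonneg hα.le (sub_nonneg.2 hc.1), mul_nonneg hγ.le (sub_nonneg.2 hc.2),
      mul_pos hβ (sub_pos.2 (h₁.trans_lt hL))]
  rcases hlt with hlt | hlt <;> rcases abs_cases (s₁ - s₀) with ⟨e, _⟩ | ⟨e, _⟩ <;>
    rcases abs_cases (s₂ - s₁) with ⟨e', _⟩ | ⟨e', _⟩ <;> linarith

theorem abs_middle_slope_le {s₀ s₁ s₂ σ₁ σ₂ σ₃ α β γ L : ℝ} (hα : 0 < α) (hβ : 0 < β) (hγ : 0 < γ)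
    (hmean : α * σ₁ + β * σ₂ + γ * σ₃ = (α + β + γ) * s₁)
    (h : |σ₁ - s₀| + |σ₂ - σ₁| + |σ₃ - σ₂| + |s₂ - σ₃| ≤ |s₁ - s₀| + |s₂ - s₁|)
    (h₀ : |s₀| ≤ L) (h₁ : |s₁| ≤ L) (h₂ : |s₂| ≤ L) : |σ₂| ≤ L := by
  rw [abs_le] at *
  refine ⟨?_, middle_slope_le hα hβ hγ hmean h h₀.2 h₁.2 h₂.2⟩
  have := middle_slope_le (s₀ := -s₀) (s₁ := -s₁) (s₂ := -s₂) (σ₁ := -σ₁) (σ₂ := -σ₂) (σ₃ := -σ₃)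
    (L := L) hα hβ hγ (by linarith) (by
      simpa only [neg_sub_neg, abs_sub_comm] using h) (by linarith) (by linarith) (by linarith)
  linarith

/-- The slope of `f` over `[X k, X (k + 1)]`. -/
noncomputable def seqSlope (f : ℝ → ℝ) (X : ℕ → ℝ) (k : ℕ) : ℝ :=
  (f (X (k + 1)) - f (X k)) / (X (k + 1) - X k)

theorem weakD2_hatSeq (f : BV2) {X : ℕ → ℝ} (hX : StrictMono X) (k : ℕ) :
    weakD2 f (hatSeq hX k) = seqSlope f X (k + 1) - seqSlope f X k :=
  weakD2_hat f _ _

theorem abs_slope_le_of_minimal {f : BV2} {X : ℕ → ℝ} (hX : StrictMono X) {N : ℕ}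
    (hw : ‖weakD2 f‖ ≤ ∑ k ∈ Finset.range N, |weakD2 f (hatSeq hX k)|) {L : ℝ} {i : ℕ}
    (hi : i + 1 < N) (hL : ∀ j ≤ i + 2, |seqSlope f X j| ≤ L) {u v : ℝ} (hu : X (i + 1) < u)
    (huv : u < v) (hv : v < X (i + 2)) :
    |((f : ℝ → ℝ) v - (f : ℝ → ℝ) u) / (v - u)| ≤ L := by
  have x0 : X i < X (i + 1) := hX (by omega)
  have x2 : X (i + 2) < X (i + 3) := hX (by omega)
  let g : Fin 4 → C₀(ℝ, ℝ) := ![hat x0 hu, hat hu huv, hat huv hv, hat hv x2]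
  have hs : ({i, i + 1} : Finset ℕ) ⊆ Finset.range N := by
    intro k hk
    simp only [Finset.mem_insert, Finset.mem_singleton] at hk
    exact Finset.mem_range.2 (by omega)
  have key := sum_abs_le_of_exchange hX hw hs g (by
      intro j t
      fin_cases j
      exacts [hat_nonneg x0 hu t, hat_nonneg hu huv t, hat_nonneg huv hv t, hat_nonneg hv x2 t]) (by
      intro t
      have h1 := Finset.sum_sdiff hs (f := fun k => hatSeq hX k t)
      rw [Finset.sum_pair (by omega)] at h1
      refine le_trans (le_of_eq ?_) (sum_hatSeq_le_one hX N t)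
      rw [← h1, Fin.sum_univ_four, add_comm, add_left_cancel_iff]
      change hat x0 hu t + hat hu huv t + hat huv hv t + hat hv x2 t = hat _ _ t + hat _ _ t
      simp only [hat_apply, Nat.succ_eq_add_one]
      ring)
  rw [Fin.sum_univ_four, Finset.sum_pair (by omega), weakD2_hatSeq, weakD2_hatSeq] at key
  change |weakD2 f (hat x0 hu)| + |weakD2 f (hat hu huv)| + |weakD2 f (hat huv hv)|
    + |weakD2 f (hat hv x2)| ≤ _ at key
  rw [weakD2_hat, weakD2_hat, weakD2_hat, weakD2_hat] at key
  have hd1 : u - X (i + 1) ≠ 0 := by linarith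
  have hd2 : v - u ≠ 0 := by linarith
  have hd3 : X (i + 2) - v ≠ 0 := by linarith
  have hd4 : X (i + 1 + 1) - X (i + 1) ≠ 0 := by linarith
  refine abs_middle_slope_le (sub_pos.2 hu) (sub_pos.2 huv) (sub_pos.2 hv) ?_ key
    (hL i (by omega)) (hL (i + 1) (by omega)) (hL (i + 2) le_rfl)
  rw [seqSlope, mul_div_cancel₀ _ hd1, mul_div_cancel₀ _ hd2, mul_div_cancel₀ _ hd3,
    show u - X (i + 1) + (v - u) + (X (i + 2) - v) = X (i + 1 + 1) - X (i + 1) by ring,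
    mul_div_cancel₀ _ hd4]
  ring

theorem abs_sub_le_of_minimal {f : BV2} {X : ℕ → ℝ} (hX : StrictMono X) {N : ℕ}
    (hw : ‖weakD2 f‖ ≤ ∑ k ∈ Finset.range N, |weakD2 f (hatSeq hX k)|) {L : ℝ} {i : ℕ}
    (hi : i + 1 < N) (hL : ∀ j ≤ i + 2, |seqSlope f X j| ≤ L) {u v : ℝ}
    (hu : u ∈ Set.Icc (X (i + 1)) (X (i + 2))) (hv : v ∈ Set.Icc (X (i + 1)) (X (i + 2))) :
    |(f : ℝ → ℝ) v - (f : ℝ → ℝ) u| ≤ L * |v - u| := by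
  have hlt : X (i + 1) < X (i + 2) := hX (by omega)
  have hcl : IsClosed {z : ℝ × ℝ | |(f : ℝ → ℝ) z.2 - (f : ℝ → ℝ) z.1| ≤ L * |z.2 - z.1|} := by
    have := f.2.1
    exact isClosed_le (by fun_prop) (by fun_prop)
  have hopen : ∀ a ∈ Set.Ioo (X (i + 1)) (X (i + 2)), ∀ b ∈ Set.Ioo (X (i + 1)) (X (i + 2)), a < b →
      |(f : ℝ → ℝ) b - (f : ℝ → ℝ) a| ≤ L * |b - a| := by
    intro a ha b hb hab
    have h := abs_slope_le_of_minimal hX hw hi hL ha.1 hab hb.2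
    rwa [abs_div, div_le_iff₀ (abs_pos.2 (by linarith))] at h
  have hsub : Set.Ioo (X (i + 1)) (X (i + 2)) ×ˢ Set.Ioo (X (i + 1)) (X (i + 2))
      ⊆ {z : ℝ × ℝ | |(f : ℝ → ℝ) z.2 - (f : ℝ → ℝ) z.1| ≤ L * |z.2 - z.1|} := by
    rintro ⟨a, b⟩ ⟨ha, hb⟩
    rcases lt_trichotomy a b with h | h | h
    · exact hopen a ha b hb h
    · change a = b at h
      subst h
      simp
    · have := hopen b hb a ha h
      rw [abs_sub_comm, abs_sub_comm a b] at this
      exact this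
  have := closure_minimal hsub hcl
  rw [closure_prod_eq, closure_Ioo hlt.ne] at this
  exact this (Set.mk_mem_prod hu hv)

theorem monotone_of_monotoneOn_pieces {g : ℝ → ℝ} {X : ℕ → ℝ} (hX : StrictMono X) (n : ℕ)
    (h0 : MonotoneOn g (Set.Iic (X 0))) (h1 : ∀ k < n, MonotoneOn g (Set.Icc (X k) (X (k + 1))))
    (h2 : MonotoneOn g (Set.Ici (X n))) : Monotone g := by
  have key : ∀ k ≤ n, MonotoneOn g (Set.Iic (X k)) := by
    intro k
    induction k with
    | zero => exact fun _ => h0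
    | succ k ih =>
      intro hk
      have hlt : X k ≤ X (k + 1) := (hX k.lt_succ_self).le
      have := (ih (by omega)).union_right (h1 k (by omega)) isGreatest_Iic (isLeast_Icc hlt)
      rwa [Set.Iic_union_Icc_eq_Iic hlt] at this
  exact (key n le_rfl).Iic_union_Ici h2

theorem slopeDiff_eq_zero_left {f : BV2} {X : ℕ → ℝ} (hX : StrictMono X) {N : ℕ}
    (hw : ‖weakD2 f‖ ≤ ∑ k ∈ Finset.range N, |weakD2 f (hatSeq hX k)|) {t : ℝ} (ht : t < X 0) :
    slopeDiff f t (X 0) (X 1) = 0 := by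
  have x1 : X 0 < X 1 := hX (by omega)
  have key := sum_abs_le_of_exchange hX hw (Finset.empty_subset _) ![hat ht x1] (by
    intro j t
    fin_cases j
    exact hat_nonneg ht x1 t) (by
    intro s
    rw [Fin.sum_univ_one, Finset.sdiff_empty, sum_hatSeq_apply]
    change hat ht x1 s + _ ≤ _
    rw [hat_apply]
    linarith [fallingStep_le_one (hX N.lt_succ_self) s, fallingStep_nonneg ht s])
  rw [Fin.sum_univ_one, Finset.sum_empty] at key
  change |weakD2 f (hat ht x1)| ≤ 0 at key
  rwa [weakD2_hat, abs_nonpos_iff] at key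

theorem slopeDiff_eq_zero_right {f : BV2} {X : ℕ → ℝ} (hX : StrictMono X) {N : ℕ}
    (hw : ‖weakD2 f‖ ≤ ∑ k ∈ Finset.range N, |weakD2 f (hatSeq hX k)|) {t : ℝ}
    (ht : X (N + 1) < t) : slopeDiff f (X N) (X (N + 1)) t = 0 := by
  have x1 : X N < X (N + 1) := hX (by omega)
  have key := sum_abs_le_of_exchange hX hw (Finset.empty_subset _) ![hat x1 ht] (by
    intro j t
    fin_cases j
    exact hat_nonneg x1 ht t) (by
    intro s
    rw [Fin.sum_univ_one, Finset.sdiff_empty, sum_hatSeq_apply]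
    change hat x1 ht s + _ ≤ _
    rw [hat_apply]
    linarith [fallingStep_le_one ht s, fallingStep_nonneg (hX Nat.zero_lt_one) s])
  rw [Fin.sum_univ_one, Finset.sum_empty] at key
  change |weakD2 f (hat x1 ht)| ≤ 0 at key
  rwa [weakD2_hat, abs_nonpos_iff] at key

theorem apply_eq_of_le_node {f : BV2} {X : ℕ → ℝ} (hX : StrictMono X) {N : ℕ}
    (hw : ‖weakD2 f‖ ≤ ∑ k ∈ Finset.range N, |weakD2 f (hatSeq hX k)|) {t : ℝ} (ht : t ≤ X 0) :
    (f : ℝ → ℝ) t = (f : ℝ → ℝ) (X 0) + seqSlope f X 0 * (t - X 0) := by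
  rcases ht.eq_or_lt with rfl | ht
  · simp
  · have h := slopeDiff_eq_zero_left hX hw ht
    rw [slopeDiff, sub_eq_zero, eq_div_iff (by linarith)] at h
    rw [seqSlope, zero_add]
    linarith

theorem apply_eq_of_node_le {f : BV2} {X : ℕ → ℝ} (hX : StrictMono X) {N : ℕ}
    (hw : ‖weakD2 f‖ ≤ ∑ k ∈ Finset.range N, |weakD2 f (hatSeq hX k)|) {t : ℝ}
    (ht : X (N + 1) ≤ t) :
    (f : ℝ → ℝ) t = (f : ℝ → ℝ) (X (N + 1)) + seqSlope f X N * (t - X (N + 1)) := by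
  rcases ht.eq_or_lt with rfl | ht
  · simp
  · have h := slopeDiff_eq_zero_right hX hw ht
    rw [slopeDiff, sub_eq_zero, div_eq_iff (by linarith)] at h
    rw [seqSlope]
    linarith

theorem abs_sub_le_on_piece {f : BV2} {X : ℕ → ℝ} (hX : StrictMono X) {N : ℕ}
    (hw : ‖weakD2 f‖ ≤ ∑ k ∈ Finset.range N, |weakD2 f (hatSeq hX k)|) {L : ℝ}
    (hL : ∀ j ≤ N, |seqSlope f X j| ≤ L) {i : ℕ} (hi : i ≤ N) {u v : ℝ}
    (hu : u ∈ Set.Icc (X i) (X (i + 1))) (hv : v ∈ Set.Icc (X i) (X (i + 1))) :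
    |(f : ℝ → ℝ) v - (f : ℝ → ℝ) u| ≤ L * |v - u| := by
  let Y : ℕ → ℝ := fun n => Nat.casesOn n (X 0 - 1) X
  have hY : StrictMono Y := by
    refine strictMono_nat_of_lt_succ fun n => ?_
    cases n with
    | zero => exact sub_one_lt (X 0)
    | succ n => exact hX n.lt_succ_self
  have hwY : ‖weakD2 f‖ ≤ ∑ k ∈ Finset.range (N + 2), |weakD2 f (hatSeq hY k)| := by
    refine hw.trans ?_
    rw [Finset.sum_range_succ', Finset.sum_range_succ, add_assoc]
    exact le_add_of_nonneg_right (by positivity)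
  have hzero : seqSlope f Y 0 = seqSlope f Y 1 := by
    have := slopeDiff_eq_zero_left hX hw (sub_one_lt (X 0))
    exact (sub_eq_zero.1 this).symm
  have hlast : seqSlope f Y (N + 2) = seqSlope f Y (N + 1) := by
    have := slopeDiff_eq_zero_right hX hw (hX (N + 1).lt_succ_self)
    exact sub_eq_zero.1 this
  have hsucc : ∀ j, seqSlope f Y (j + 1) = seqSlope f X j := fun j => rfl
  have hLY : ∀ j ≤ N + 2, |seqSlope f Y j| ≤ L := by
    intro j hj
    rcases j with _ | j
    · rw [hzero, hsucc]
      exact hL 0 (Nat.zero_le N)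
    · rcases (show j ≤ N ∨ j = N + 1 by omega) with h | rfl
      · rw [hsucc]
        exact hL j h
      · rw [hlast, hsucc]
        exact hL N le_rfl
  exact abs_sub_le_of_minimal hY hwY (i := i) (by omega) (fun j hj => hLY j (by omega)) hu hv

theorem abs_sub_le_of_norm_le {f : BV2} {X : ℕ → ℝ} (hX : StrictMono X) {N : ℕ}
    (hw : ‖weakD2 f‖ ≤ ∑ k ∈ Finset.range N, |weakD2 f (hatSeq hX k)|) {L : ℝ}
    (hL : ∀ j ≤ N, |seqSlope f X j| ≤ L) (u v : ℝ) :
    |(f : ℝ → ℝ) v - (f : ℝ → ℝ) u| ≤ L * |v - u| := by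
  have mono : ∀ ε : ℝ, |ε| = 1 → Monotone fun t => L * t + ε * (f : ℝ → ℝ) t := by
    intro ε hε
    have ray : ∀ s x₀ y₀ a b : ℝ, |s| ≤ L → a ≤ b →
        L * a + ε * (y₀ + s * (a - x₀)) ≤ L * b + ε * (y₀ + s * (b - x₀)) := by
      intro s x₀ y₀ a b hs hab
      have h1 : |ε * s| ≤ L := by rwa [abs_mul, hε, one_mul]
      nlinarith [mul_nonneg (sub_nonneg.2 hab) (by linarith [(abs_le.1 h1).1] : 0 ≤ L + ε * s)]
    refine monotone_of_monotoneOn_pieces hX (N + 1) ?_ ?_ ?_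
    · intro a ha b hb hab
      simp only [apply_eq_of_le_node hX hw ha, apply_eq_of_le_node hX hw hb]
      exact ray _ _ _ a b (hL 0 (Nat.zero_le N)) hab
    · intro k hk a ha b hb hab
      have h := abs_sub_le_on_piece hX hw hL (i := k) (by omega) ha hb
      rw [abs_of_nonneg (sub_nonneg.2 hab)] at h
      have h1 : |ε * ((f : ℝ → ℝ) b - (f : ℝ → ℝ) a)| ≤ L * (b - a) := by rwa [abs_mul, hε, one_mul]
      have := (abs_le.1 h1).1
      simp only
      linarith
    · intro a ha b hb hab
      simp only [apply_eq_of_node_le hX hw ha, apply_eq_of_node_le hX hw hb]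
      exact ray _ _ _ a b (hL N le_rfl) hab
  wlog huv : u ≤ v generalizing u v
  · rw [abs_sub_comm, abs_sub_comm v]
    exact this v u (le_of_not_ge huv)
  have h1 := mono 1 (by simp) huv
  have h2 := mono (-1) (by simp) huv
  simp only at h1 h2
  rw [abs_of_nonneg (sub_nonneg.2 huv), abs_le]
  constructor <;> linarith

/-! ### The canonical interpolant -/

/-- The slope of the data `(X, Z)` between the nodes `k` and `k + 1`. -/
noncomputable def nodeSlope (X Z : ℕ → ℝ) (k : ℕ) : ℝ := (Z (k + 1) - Z k) / (X (k + 1) - X k)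

theorem seqSlope_eq_nodeSlope (f : ℝ → ℝ) (X : ℕ → ℝ) :
    seqSlope f X = nodeSlope X (fun n => f (X n)) := rfl

theorem nodeSlope_congr {X Z Z' : ℕ → ℝ} {N : ℕ} (h : ∀ m ≤ N + 1, Z m = Z' m) {k : ℕ}
    (hk : k ≤ N) : nodeSlope X Z k = nodeSlope X Z' k := by
  rw [nodeSlope, nodeSlope, h k (by omega), h (k + 1) (by omega)]

theorem eq_of_nodeSlope_sub_eq {X Z Z' : ℕ → ℝ} (hX : StrictMono X) {N : ℕ} (h0 : Z 0 = Z' 0)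
    (h1 : Z 1 = Z' 1) (h : ∀ k < N, nodeSlope X Z (k + 1) - nodeSlope X Z k
      = nodeSlope X Z' (k + 1) - nodeSlope X Z' k) : ∀ m ≤ N + 1, Z m = Z' m := by
  have hs : ∀ k ≤ N, nodeSlope X Z k = nodeSlope X Z' k := by
    intro k
    induction k with
    | zero => intro _; simp only [nodeSlope, h0, zero_add, h1]
    | succ k ih =>
      intro hk
      have := h k (by omega)
      have := ih (by omega)
      linarith
  intro m
  induction m with
  | zero => exact fun _ => h0
  | succ m ih =>
    intro hm
    have h2 := hs m (by omega)
    have h3 := ih (by omega)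
    have h4 : X (m + 1) - X m ≠ 0 := sub_ne_zero.2 (hX m.lt_succ_self).ne'
    rw [nodeSlope, nodeSlope, div_left_inj' h4] at h2
    linarith

theorem hatSeq_apply_node {X : ℕ → ℝ} (hX : StrictMono X) (j k : ℕ) :
    hatSeq hX j (X (k + 1)) = if k = j then 1 else 0 := by
  split_ifs with h
  · subst h
    exact hat_center _ _
  · rcases lt_or_gt_of_ne h with h | h
    · exact hat_of_le _ _ (hX.monotone (by omega))
    · exact hat_of_ge _ _ (hX.monotone (by simp only [Nat.succ_eq_add_one]; omega))

theorem norm_le_of_forall_apply_le {u : StrongDual ℝ C₀(ℝ, ℝ)} {C : ℝ} (hC : 0 ≤ C)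
    (h : ∀ φ : C₀(ℝ, ℝ), (∀ t, |φ t| ≤ 1) → u φ ≤ C) : ‖u‖ ≤ C := by
  refine ContinuousLinearMap.opNorm_le_of_unit_norm hC fun φ hφ => ?_
  have hb : ∀ t, |φ t| ≤ 1 := fun t => (C0.abs_apply_le φ t).trans hφ.le
  rw [Real.norm_eq_abs, abs_le]
  refine ⟨?_, h φ hb⟩
  have := h (-φ) fun t => by
    rw [ZeroAtInftyContinuousMap.neg_apply, abs_neg]
    exact hb t
  rw [map_neg] at this
  linarith

/-- The piecewise linear interpolant of the data. -/
theorem exists_interpolant {X : ℕ → ℝ} (hX : StrictMono X) (Z : ℕ → ℝ) (N : ℕ) :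
    ∃ f : BV2, (∀ m ≤ N + 1, (f : ℝ → ℝ) (X m) = Z m) ∧
      ‖weakD2 f‖ ≤ ∑ k ∈ Finset.range N, |nodeSlope X Z (k + 1) - nodeSlope X Z k| := by
  set c : ℕ → ℝ := fun k => nodeSlope X Z (k + 1) - nodeSlope X Z k with hc
  let w : StrongDual ℝ C₀(ℝ, ℝ) := ∑ k ∈ Finset.range N, c k • C0.dirac (X (k + 1))
  have h01 : X 0 < X 1 := hX Nat.zero_lt_one
  refine ⟨BV2.ofD2 h01 (Z 0) (Z 1) w, ?_, ?_⟩
  · refine eq_of_nodeSlope_sub_eq hX (Z := fun n => (BV2.ofD2 h01 (Z 0) (Z 1) w : ℝ → ℝ) (X n))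
      (BV2.ofD2_left h01 _ _ w) (BV2.ofD2_right h01 _ _ w) fun j hj => ?_
    rw [← seqSlope_eq_nodeSlope, ← weakD2_hatSeq _ hX, weakD2_ofD2]
    change w (hatSeq hX j) = c j
    have : w (hatSeq hX j) = ∑ k ∈ Finset.range N, c k * hatSeq hX j (X (k + 1)) := by
      simp [w]
    rw [this]
    simp only [hatSeq_apply_node, mul_ite, mul_one, mul_zero, Finset.sum_ite_eq',
      Finset.mem_range, hj, if_true]
  · rw [weakD2_ofD2]
    refine norm_le_of_forall_apply_le (Finset.sum_nonneg fun k _ => abs_nonneg _) fun φ hφ => ?_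
    have : w φ = ∑ k ∈ Finset.range N, c k * φ (X (k + 1)) := by simp [w]
    rw [this]
    refine Finset.sum_le_sum fun k _ => (le_abs_self _).trans ?_
    rw [abs_mul]
    exact mul_le_of_le_one_right (abs_nonneg _) (hφ _)

/-! ### Perturbation of minimal interpolants -/

/-- The functional `ρ • w : φ ↦ w (ρ φ)`. -/
noncomputable def mulDual (ρ : C₀(ℝ, ℝ)) (w : StrongDual ℝ C₀(ℝ, ℝ)) : StrongDual ℝ C₀(ℝ, ℝ) :=
  w.comp (ContinuousLinearMap.mul ℝ C₀(ℝ, ℝ) ρ)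

theorem norm_add_mulDual_le {w : StrongDual ℝ C₀(ℝ, ℝ)} {η ρ : C₀(ℝ, ℝ)} (hη : ∀ t, |η t| ≤ 1)
    (hw : ‖w‖ ≤ w η) (hρ : ∀ t, |ρ t| ≤ 1) (h0 : w (ρ * η) = 0) : ‖w + mulDual ρ w‖ ≤ ‖w‖ := by
  refine norm_le_of_forall_apply_le (norm_nonneg w) fun φ hφ => ?_
  have h := apply_le_norm (w := w) (η := (2⁻¹ : ℝ) • (η - ρ * η + φ + ρ * φ)) fun t => by
    have e : ((2⁻¹ : ℝ) • (η - ρ * η + φ + ρ * φ)) t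
        = 2⁻¹ * ((1 - ρ t) * η t + (1 + ρ t) * φ t) := by
      simp
      ring
    have h1 := abs_le.1 (hη t)
    have h2 := abs_le.1 (hρ t)
    have h3 := abs_le.1 (hφ t)
    rw [e, abs_le]
    constructor <;> nlinarith
  rw [map_smul, map_add, map_add, map_sub, h0, smul_eq_mul] at h
  change w φ + w (ρ * φ) ≤ ‖w‖
  linarith

theorem mulDual_eq_zero_of_extreme {f : BV2} {X : ℕ → ℝ} (hX : StrictMono X) {N : ℕ}
    (hw : ‖weakD2 f‖ ≤ ∑ k ∈ Finset.range N, |weakD2 f (hatSeq hX k)|)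
    (hext : ∀ g h : BV2, (∀ m ≤ N + 1, (g : ℝ → ℝ) (X m) = (f : ℝ → ℝ) (X m)) →
      (∀ m ≤ N + 1, (h : ℝ → ℝ) (X m) = (f : ℝ → ℝ) (X m)) → ‖weakD2 g‖ ≤ ‖weakD2 f‖ →
      ‖weakD2 h‖ ≤ ‖weakD2 f‖ → g + h = (2 : ℝ) • f → g = f)
    {ρ : C₀(ℝ, ℝ)} (h0 : ∀ k < N, weakD2 f (ρ * hatSeq hX k) = 0) (φ : C₀(ℝ, ℝ)) :
    weakD2 f (ρ * φ) = 0 := by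
  wlog hρ : ∀ t, |ρ t| ≤ 1 generalizing ρ
  · have hpos : 0 < ‖ρ‖ + 1 := by positivity
    have := this (ρ := (‖ρ‖ + 1)⁻¹ • ρ) (fun k hk => by
      rw [smul_mul_assoc, map_smul, h0 k hk, smul_zero]) fun t => by
        rw [ZeroAtInftyContinuousMap.smul_apply, smul_eq_mul, abs_mul, abs_inv, abs_of_pos hpos,
          inv_mul_le_one₀ hpos]
        linarith [C0.abs_apply_le ρ t]
    rw [smul_mul_assoc, map_smul, smul_eq_mul, mul_eq_zero] at this
    exact this.resolve_left (inv_ne_zero hpos.ne')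
  set w := weakD2 f with hwdef
  obtain ⟨η, ⟨ε, hε⟩, hη, hwη⟩ := sum_abs_le_norm w (Finset.range N) (hatSeq hX)
    (fun i _ t => hatSeq_nonneg hX i t) (sum_hatSeq_le_one hX N)
  rw [← hwη] at hw
  have hρη : w (ρ * η) = 0 := by
    rw [hε, Finset.mul_sum, map_sum]
    refine Finset.sum_eq_zero fun k hk => ?_
    rw [mul_smul_comm, map_smul, h0 k (Finset.mem_range.1 hk), smul_zero]
  have h01 : X 0 < X 1 := hX Nat.zero_lt_one
  let G : C₀(ℝ, ℝ) → BV2 := fun σ =>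
    BV2.ofD2 h01 ((f : ℝ → ℝ) (X 0)) ((f : ℝ → ℝ) (X 1)) (w + mulDual σ w)
  have hG : ∀ σ : C₀(ℝ, ℝ), (∀ k < N, w (σ * hatSeq hX k) = 0) →
      ∀ m ≤ N + 1, (G σ : ℝ → ℝ) (X m) = (f : ℝ → ℝ) (X m) := by
    intro σ hσ
    refine eq_of_nodeSlope_sub_eq hX (Z := fun n => (G σ : ℝ → ℝ) (X n))
      (Z' := fun n => (f : ℝ → ℝ) (X n))
      (BV2.ofD2_left h01 _ _ _) (BV2.ofD2_right h01 _ _ _) fun j hj => ?_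
    rw [← seqSlope_eq_nodeSlope, ← seqSlope_eq_nodeSlope, ← weakD2_hatSeq _ hX,
      ← weakD2_hatSeq _ hX, weakD2_ofD2]
    change w (hatSeq hX j) + w (σ * hatSeq hX j) = w (hatSeq hX j)
    rw [hσ j hj, add_zero]
  have hnρ : ∀ ψ, w (-ρ * ψ) = -w (ρ * ψ) := fun ψ => by
    have e : -ρ * ψ = -(ρ * ψ) := by
      ext t
      simp
    rw [e, map_neg]
  have hfG : G ρ = f := by
    refine hext (G ρ) (G (-ρ)) (hG ρ h0) (hG (-ρ) fun k hk => ?_) ?_ ?_ ?_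
    · rw [hnρ, h0 k hk, neg_zero]
    · rw [weakD2_ofD2]
      exact norm_add_mulDual_le hη hw hρ hρη
    · rw [weakD2_ofD2]
      refine norm_add_mulDual_le hη hw (fun t => ?_) (by rw [hnρ, hρη, neg_zero])
      rw [ZeroAtInftyContinuousMap.neg_apply, abs_neg]
      exact hρ t
    · refine Subtype.ext (funext fun x => ?_)
      change (G ρ : ℝ → ℝ) x + (G (-ρ) : ℝ → ℝ) x = 2 * (f : ℝ → ℝ) x
      have e : ∀ σ, (w + mulDual σ w) (peanoC0 h01 x)
        = w (peanoC0 h01 x) + w (σ * peanoC0 h01 x) := fun σ => rfl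
      rw [BV2.ofD2_apply, BV2.ofD2_apply, BV2.apply_eq h01 f x, e, e, hnρ]
      ring
  have h := congrArg (fun g => weakD2 g φ) hfG
  simp only [G, weakD2_ofD2] at h
  change w φ + w (ρ * φ) = w φ at h
  linarith

/-! ### Extreme points are splines -/

/-- The points near which `f` is not affine. -/
def knotSet (f : ℝ → ℝ) : Set ℝ :=
  {t | ∀ U ∈ 𝓝 t, ∃ a b c, a < b ∧ b < c ∧ Set.Icc a c ⊆ U ∧ slopeDiff f a b c ≠ 0}

/-- The square root of a function in `C₀(ℝ)`. -/
noncomputable def C0.sqrt (g : C₀(ℝ, ℝ)) : C₀(ℝ, ℝ) where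
  toFun t := √(g t)
  continuous_toFun := g.continuous.sqrt
  zero_at_infty' := by
    have := (Real.continuous_sqrt.tendsto 0).comp g.zero_at_infty'
    rwa [Real.sqrt_zero] at this

@[simp] theorem C0.sqrt_apply (g : C₀(ℝ, ℝ)) (t : ℝ) : C0.sqrt g t = √(g t) := rfl

theorem exists_disjoint_hats {f : BV2} {S : Finset ℝ} (hS : (S : Set ℝ) ⊆ knotSet f) :
    ∃ ρ : S → C₀(ℝ, ℝ), (∀ s, weakD2 f (ρ s * ρ s) ≠ 0) ∧ ∀ s t, s ≠ t → ρ s * ρ t = 0 := by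
  obtain ⟨U, hU, hd⟩ := S.finite_toSet.t2_separation
  have h : ∀ s : S, ∃ ρ : C₀(ℝ, ℝ), weakD2 f (ρ * ρ) ≠ 0 ∧ ∀ t ∉ U s, ρ t = 0 := by
    rintro ⟨s, hs⟩
    obtain ⟨a, b, c, hab, hbc, hsub, hne⟩ := hS hs (U s) ((hU s).2.mem_nhds (hU s).1)
    refine ⟨C0.sqrt (hat hab hbc), ?_, fun t ht => ?_⟩
    · have : C0.sqrt (hat hab hbc) * C0.sqrt (hat hab hbc) = hat hab hbc := by
        ext t
        simp [Real.mul_self_sqrt (hat_nonneg hab hbc t)]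
      rwa [this, weakD2_hat]
    · have h1 : t ∉ Set.Icc a c := fun h => ht (hsub h)
      rw [Set.mem_Icc, not_and_or, not_le, not_le] at h1
      rw [C0.sqrt_apply]
      rcases h1 with h1 | h1
      · rw [hat_of_le hab hbc h1.le, Real.sqrt_zero]
      · rw [hat_of_ge hab hbc h1.le, Real.sqrt_zero]
  choose ρ h1 h2 using h
  refine ⟨ρ, h1, fun s t hst => ?_⟩
  ext x
  rw [ZeroAtInftyContinuousMap.mul_apply, ZeroAtInftyContinuousMap.zero_apply]
  by_cases hx : x ∈ U s
  · have : x ∉ U t := fun hx' =>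
      Set.disjoint_left.1 (hd s.2 t.2 fun h => hst (Subtype.ext h)) hx hx'
    rw [h2 t x this, mul_zero]
  · rw [h2 s x hx, zero_mul]

theorem card_le_of_subset_knotSet {f : BV2} {N : ℕ} (h : Fin N → C₀(ℝ, ℝ))
    (hf : ∀ ρ : C₀(ℝ, ℝ), (∀ k, weakD2 f (ρ * h k) = 0) → ∀ φ, weakD2 f (ρ * φ) = 0)
    {S : Finset ℝ} (hS : (S : Set ℝ) ⊆ knotSet f) : S.card ≤ N := by
  by_contra! hcard
  obtain ⟨ρ, h1, h2⟩ := exists_disjoint_hats hS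
  let A : (S → ℝ) →ₗ[ℝ] (Fin N → ℝ) :=
    LinearMap.pi fun k => ∑ s, (weakD2 f (ρ s * h k)) • LinearMap.proj s
  have hker : LinearMap.ker A ≠ ⊥ := A.ker_ne_bot_of_finrank_lt (by simpa using hcard)
  obtain ⟨α, hα, hα0⟩ := (Submodule.ne_bot_iff _).1 hker
  have hA : ∀ k, ∑ s, α s * weakD2 f (ρ s * h k) = 0 := fun k => by
    have := congrFun (LinearMap.mem_ker.1 hα) k
    simpa [A, mul_comm] using this
  have hsum : ∀ ψ, weakD2 f ((∑ s, α s • ρ s) * ψ) = ∑ s, α s * weakD2 f (ρ s * ψ) := fun ψ => by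
    rw [Finset.sum_mul, map_sum]
    refine Finset.sum_congr rfl fun s _ => ?_
    rw [smul_mul_assoc, map_smul, smul_eq_mul]
  refine hα0 (funext fun s => ?_)
  have h3 := hf (∑ s, α s • ρ s) (fun k => (hsum _).trans (hA k)) (ρ s)
  rw [hsum, Finset.sum_eq_single s (fun t _ hts => by rw [h2 t s hts, map_zero, mul_zero])
    (by simp), mul_eq_zero] at h3
  exact h3.resolve_right (h1 s)

theorem eventually_affine_of_notMem_knotSet {f : ℝ → ℝ} {t : ℝ} (ht : t ∉ knotSet f) :
    ∃ a b : ℝ, ∀ᶠ x in 𝓝 t, f x = a * x + b := by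
  simp only [knotSet, Set.mem_ofPred_eq, not_forall, not_exists, not_and, not_not] at ht
  obtain ⟨U, hU, h⟩ := ht
  obtain ⟨ε, hε, hball⟩ := Metric.mem_nhds_iff.1 hU
  rw [Real.ball_eq_Ioo] at hball
  set p := t - ε / 2 with hp
  set q := t + ε / 2 with hq
  refine ⟨(f q - f p) / (q - p), f p - (f q - f p) / (q - p) * p, ?_⟩
  have hpt : p < t := by linarith
  have htq : t < q := by linarith
  filter_upwards [Ioo_mem_nhds hpt htq] with x hx
  have h1 := h p x q hx.1 hx.2 fun y hy => hball ⟨by linarith [hy.1], by linarith [hy.2]⟩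
  have d1 : q - x ≠ 0 := by linarith [hx.2]
  have d2 : x - p ≠ 0 := by linarith [hx.1]
  have d3 : q - p ≠ 0 := by linarith
  rw [slopeDiff, sub_eq_zero, div_eq_div_iff d1 d2] at h1
  field_simp
  linarith

theorem affine_coeff_unique {f : ℝ → ℝ} {t a b a' b' : ℝ} (h : ∀ᶠ x in 𝓝 t, f x = a * x + b)
    (h' : ∀ᶠ x in 𝓝 t, f x = a' * x + b') : a = a' ∧ b = b' := by
  obtain ⟨ε, hε, hball⟩ := Metric.eventually_nhds_iff.1 (h.and h')
  have h1 := hball (y := t) (by simpa using hε)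
  have h2 := hball (y := t + ε / 2) (by
    rw [Real.dist_eq, add_sub_cancel_left, abs_of_pos (by linarith)]
    linarith)
  have ha : (a - a') * (ε / 2) = 0 := by linarith [h1.1, h1.2, h2.1, h2.2]
  have ha' : a = a' := by
    rcases mul_eq_zero.1 ha with h | h <;> linarith
  refine ⟨ha', ?_⟩
  subst ha'
  linarith [h1.1, h1.2]

theorem affine_on_of_disjoint_knotSet {f : ℝ → ℝ} {I : Set ℝ} (hI : I.OrdConnected)
    (hd : Disjoint I (knotSet f)) : ∃ a b : ℝ, ∀ t ∈ I, f t = a * t + b := by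
  rcases I.eq_empty_or_nonempty with rfl | ⟨s, hs⟩
  · exact ⟨0, 0, by simp⟩
  have hloc : ∀ t ∈ I, ∃ a b : ℝ, ∀ᶠ x in 𝓝 t, f x = a * x + b := fun t ht =>
    eventually_affine_of_notMem_knotSet (Set.disjoint_left.1 hd ht)
  let P : ℝ → ℝ → Prop := fun s t => ∃ a b : ℝ, (∀ᶠ x in 𝓝 s, f x = a * x + b) ∧
    ∀ᶠ x in 𝓝 t, f x = a * x + b
  obtain ⟨a, b, hab⟩ := hloc s hs
  refine ⟨a, b, fun t ht => ?_⟩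
  have hP : P s t := by
    refine hI.isPreconnected.induction₂ P (fun u hu => ?_) (fun u v w hu hv hw => ?_)
      (fun u v _ _ => ?_) hs ht
    · obtain ⟨a, b, h⟩ := hloc u hu
      filter_upwards [mem_nhdsWithin_of_mem_nhds h.eventually_nhds] with v hv
      exact ⟨a, b, h, hv⟩
    · rintro ⟨a, b, h1, h2⟩ ⟨a', b', h3, h4⟩
      obtain ⟨rfl, rfl⟩ := affine_coeff_unique h2 h3
      exact ⟨a, b, h1, h4⟩
    · rintro ⟨a, b, h1, h2⟩
      exact ⟨a, b, h2, h1⟩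
  obtain ⟨a', b', h1, h2⟩ := hP
  obtain ⟨rfl, rfl⟩ := affine_coeff_unique hab h1
  exact h2.self_of_nhds

theorem isLinearSpline_of_knotSet {f : ℝ → ℝ} (hf : Continuous f) {N : ℕ}
    (h : ∀ S : Finset ℝ, (S : Set ℝ) ⊆ knotSet f → S.card ≤ N) : IsLinearSpline f (N + 1) := by
  have hfin : (knotSet f).Finite := by
    by_contra hinf
    obtain ⟨S, hS, hcard⟩ := Set.Infinite.exists_subset_card_eq hinf (N + 1)
    have := h S hS
    omega
  refine ⟨hf, hfin.toFinset, Nat.succ_le_succ (h _ (by simp)), fun I hI hd => ?_⟩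
  exact affine_on_of_disjoint_knotSet hI (by simpa using hd)

/-! ### The finite-dimensional problem -/

theorem exists_unique_min_of_strictConvex {M : ℕ} (E : ℝ → ℝ → ℝ) (y : Fin M → ℝ)
    (hE_convex : ∀ v, StrictConvexOn ℝ Set.univ (fun u => E u v))
    (hE_coercive : ∀ v, Filter.Tendsto (fun u => E u v) (Filter.cocompact ℝ) Filter.atTop)
    {R : (Fin M → ℝ) → ℝ} (hR : Continuous R) (hR0 : ∀ z, 0 ≤ R z)
    (hRc : ∀ z z', R ((2⁻¹ : ℝ) • (z + z')) ≤ 2⁻¹ * (R z + R z'))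
    {C : Set (Fin M → ℝ)} (hC : IsClosed C) (hCne : C.Nonempty)
    (hCc : ∀ z ∈ C, ∀ z' ∈ C, (2⁻¹ : ℝ) • (z + z') ∈ C) :
    ∃ z ∈ C, (∀ z' ∈ C, ∑ m, E (z m) (y m) + R z ≤ ∑ m, E (z' m) (y m) + R z') ∧
      ∀ z' ∈ C, ∑ m, E (z' m) (y m) + R z' ≤ ∑ m, E (z m) (y m) + R z → z' = z := by
  have hEc : ∀ v, Continuous fun u => E u v := fun v =>
    continuousOn_univ.1 ((hE_convex v).convexOn.continuousOn isOpen_univ)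
  set F : (Fin M → ℝ) → ℝ := fun z => ∑ m, E (z m) (y m) + R z with hF
  have hFc : Continuous F :=
    (continuous_finsetSum _ fun m _ => (hEc (y m)).comp (continuous_apply m)).add hR
  obtain ⟨z₀, hz₀⟩ := hCne
  choose b hb using fun m => (hEc (y m)).exists_forall_le (hE_coercive (y m))
  set B : Fin M → ℝ := fun m => E (b m) (y m) with hB
  have hQ : ∀ m, ∃ Q : Set ℝ, IsCompact Q ∧ ∀ u ∉ Q, F z₀ - ∑ j, B j + B m < E u (y m) := by
    intro m
    have h := (hE_coercive (y m)).eventually_gt_atTop (F z₀ - ∑ j, B j + B m)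
    obtain ⟨Q, hQ, hQs⟩ := Filter.mem_cocompact.1 h
    exact ⟨Q, hQ, fun u hu => hQs hu⟩
  choose Q hQc hQ using hQ
  have hout : ∀ z, F z ≤ F z₀ → z ∈ Set.univ.pi Q := by
    intro z hz m _
    by_contra hm
    have h1 := hQ m (z m) hm
    have h2 : E (z m) (y m) - B m ≤ ∑ j, (E (z j) (y j) - B j) :=
      Finset.single_le_sum (f := fun j => E (z j) (y j) - B j)
        (fun j _ => sub_nonneg.2 (hb j (z j))) (Finset.mem_univ m)
    rw [Finset.sum_sub_distrib] at h2
    have h3 := hR0 z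
    simp only [hF] at hz h1
    linarith
  have hcomp : IsCompact (Set.univ.pi Q ∩ C) := (isCompact_univ_pi hQc).inter_right hC
  obtain ⟨z, hz, hmin⟩ := hcomp.exists_isMinOn ⟨z₀, hout z₀ le_rfl, hz₀⟩ hFc.continuousOn
  have hmin' : ∀ z' ∈ C, F z ≤ F z' := by
    intro z' hz'
    rcases le_total (F z') (F z₀) with h | h
    · exact hmin ⟨hout z' h, hz'⟩
    · exact (hmin ⟨hout z₀ le_rfl, hz₀⟩).trans h
  refine ⟨z, hz.2, hmin', fun z' hz' hle => ?_⟩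
  by_contra hne
  obtain ⟨i, hi⟩ := Function.ne_iff.1 hne
  have e : ∀ m, ((2⁻¹ : ℝ) • (z + z')) m = 2⁻¹ * z m + 2⁻¹ * z' m := fun m => by
    simp [mul_add]
  have hlt : ∑ m, E (((2⁻¹ : ℝ) • (z + z')) m) (y m)
      < ∑ m, (2⁻¹ * E (z m) (y m) + 2⁻¹ * E (z' m) (y m)) := by
    refine Finset.sum_lt_sum (fun m _ => ?_) ⟨i, Finset.mem_univ i, ?_⟩
    · rw [e]
      exact (hE_convex (y m)).convexOn.2 (Set.mem_univ (z m)) (Set.mem_univ (z' m))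
        (by norm_num) (by norm_num) (by norm_num)
    · rw [e]
      exact (hE_convex (y i)).2 (Set.mem_univ (z i)) (Set.mem_univ (z' i)) (Ne.symm hi)
        (by norm_num) (by norm_num) (by norm_num)
  rw [Finset.sum_add_distrib, ← Finset.mul_sum, ← Finset.mul_sum] at hlt
  have h1 := hmin' _ (hCc z hz.2 z' hz')
  have h2 := hRc z z'
  simp only [hF] at h1
  linarith

/-! ### Finite data as sequences -/

/-- The data extended by zero. -/
noncomputable def dataSeq {M : ℕ} (z : Fin M → ℝ) (n : ℕ) : ℝ := if h : n < M then z ⟨n, h⟩ else 0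

/-- The nodes, continued with unit steps. -/
noncomputable def nodeSeq {N : ℕ} (x : Fin (N + 2) → ℝ) (n : ℕ) : ℝ :=
  if h : n < N + 2 then x ⟨n, h⟩ else x (Fin.last (N + 1)) + (n - (N + 1))

theorem dataSeq_val {M : ℕ} (z : Fin M → ℝ) (m : Fin M) : dataSeq z m = z m := by
  simp [dataSeq]

theorem nodeSeq_val {N : ℕ} (x : Fin (N + 2) → ℝ) (m : Fin (N + 2)) : nodeSeq x m = x m := by
  simp [nodeSeq]

theorem strictMono_nodeSeq {N : ℕ} {x : Fin (N + 2) → ℝ} (hx : StrictMono x) :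
    StrictMono (nodeSeq x) := by
  refine strictMono_nat_of_lt_succ fun n => ?_
  rcases lt_trichotomy (n + 1) (N + 2) with h | h | h
  · rw [nodeSeq, nodeSeq, dif_pos h, dif_pos (by omega)]
    exact hx (Fin.mk_lt_mk.2 n.lt_succ_self)
  · obtain rfl : n = N + 1 := by omega
    rw [nodeSeq, nodeSeq, dif_pos (by omega), dif_neg (by omega)]
    have : (⟨N + 1, by omega⟩ : Fin (N + 2)) = Fin.last (N + 1) := rfl
    rw [this]
    push_cast
    linarith
  · rw [nodeSeq, nodeSeq, dif_neg (by omega), dif_neg (by omega)]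
    push_cast
    linarith

theorem forall_node_iff {N : ℕ} (x z : Fin (N + 2) → ℝ) (f : ℝ → ℝ) :
    (∀ m, f (x m) = z m) ↔ ∀ n ≤ N + 1, f (nodeSeq x n) = dataSeq z n := by
  constructor
  · intro h n hn
    have := h ⟨n, by omega⟩
    rwa [← nodeSeq_val x, ← dataSeq_val z] at this
  · intro h m
    rw [← nodeSeq_val x m, ← dataSeq_val z m]
    exact h m (by omega)

theorem slopeVariation_eq_sum {N : ℕ} (x z : Fin (N + 2) → ℝ) :
    slopeVariation x z = ∑ k ∈ Finset.range N,
      |nodeSlope (nodeSeq x) (dataSeq z) (k + 1) - nodeSlope (nodeSeq x) (dataSeq z) k| := by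
  rw [Finset.sum_range]
  refine Finset.sum_congr rfl fun i _ => ?_
  have hi : (i : ℕ) < N := i.2
  have e : ∀ j (hj : j < N + 2), nodeSeq x j = x ⟨j, hj⟩ ∧ dataSeq z j = z ⟨j, hj⟩ := fun j hj =>
    ⟨nodeSeq_val x ⟨j, hj⟩, dataSeq_val z ⟨j, hj⟩⟩
  simp only [nodeSlope]
  rw [(e i (by omega)).1, (e (i + 1) (by omega)).1, (e (i + 1 + 1) (by omega)).1,
    (e i (by omega)).2, (e (i + 1) (by omega)).2, (e (i + 1 + 1) (by omega)).2, abs_sub_comm]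
  congr 2
  rw [← neg_div_neg_eq, neg_sub, neg_sub]

theorem continuous_nodeSlope (X : ℕ → ℝ) (M k : ℕ) :
    Continuous fun z : Fin M → ℝ => nodeSlope X (dataSeq z) k := by
  have h : ∀ n, Continuous fun z : Fin M → ℝ => dataSeq z n := by
    intro n
    unfold dataSeq
    split_ifs
    · exact continuous_apply _
    · exact continuous_const
  exact ((h (k + 1)).sub (h k)).div_const _

theorem nodeSlope_midpoint (X : ℕ → ℝ) {M : ℕ} (z z' : Fin M → ℝ) (k : ℕ) :
    nodeSlope X (dataSeq ((2⁻¹ : ℝ) • (z + z'))) k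
      = 2⁻¹ * (nodeSlope X (dataSeq z) k + nodeSlope X (dataSeq z') k) := by
  have h : ∀ n, dataSeq ((2⁻¹ : ℝ) • (z + z')) n = 2⁻¹ * (dataSeq z n + dataSeq z' n) := by
    intro n
    unfold dataSeq
    split_ifs <;> simp
  rw [nodeSlope, nodeSlope, nodeSlope, h, h]
  ring

theorem abs_half_add_le (a b : ℝ) : |2⁻¹ * (a + b)| ≤ 2⁻¹ * (|a| + |b|) := by
  rw [abs_mul, abs_of_pos (by norm_num : (0 : ℝ) < 2⁻¹)]
  exact mul_le_mul_of_nonneg_left (abs_add_le a b) (by norm_num)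

theorem continuous_slopeVariation {N : ℕ} (x : Fin (N + 2) → ℝ) :
    Continuous (slopeVariation x) := by
  have : slopeVariation x = fun z => ∑ k ∈ Finset.range N,
      |nodeSlope (nodeSeq x) (dataSeq z) (k + 1) - nodeSlope (nodeSeq x) (dataSeq z) k| :=
    funext (slopeVariation_eq_sum x)
  rw [this]
  exact continuous_finsetSum _ fun k _ =>
    ((continuous_nodeSlope _ _ (k + 1)).sub (continuous_nodeSlope _ _ k)).abs

theorem slopeVariation_nonneg {M : ℕ} (x z : Fin M → ℝ) : 0 ≤ slopeVariation x z :=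
  Finset.sum_nonneg fun _ _ => abs_nonneg _

theorem slopeVariation_midpoint_le {N : ℕ} (x z z' : Fin (N + 2) → ℝ) :
    slopeVariation x ((2⁻¹ : ℝ) • (z + z'))
      ≤ 2⁻¹ * (slopeVariation x z + slopeVariation x z') := by
  simp only [slopeVariation_eq_sum, nodeSlope_midpoint]
  rw [← Finset.sum_add_distrib, Finset.mul_sum]
  refine Finset.sum_le_sum fun k _ => ?_
  rw [← mul_sub, add_sub_add_comm]
  exact abs_half_add_le _ _

/-! ### Minimal interpolants -/

theorem abs_weakD2_hatSeq {N : ℕ} {x z : Fin (N + 2) → ℝ} (hx : StrictMono x) {f : BV2}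
    (hf : ∀ m, (f : ℝ → ℝ) (x m) = z m) :
    ∑ k ∈ Finset.range N, |weakD2 f (hatSeq (strictMono_nodeSeq hx) k)| = slopeVariation x z := by
  rw [slopeVariation_eq_sum]
  refine Finset.sum_congr rfl fun k hk => ?_
  have hk := Finset.mem_range.1 hk
  have h := (forall_node_iff x z f).1 hf
  rw [weakD2_hatSeq, seqSlope_eq_nodeSlope, nodeSlope_congr (N := N) h (k := k + 1) (by omega),
    nodeSlope_congr (N := N) h (k := k) (by omega)]

theorem slopeVariation_le_norm {N : ℕ} {x z : Fin (N + 2) → ℝ} (hx : StrictMono x) {f : BV2}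
    (hf : ∀ m, (f : ℝ → ℝ) (x m) = z m) : slopeVariation x z ≤ ‖weakD2 f‖ := by
  rw [← abs_weakD2_hatSeq hx hf]
  exact sum_abs_hatSeq_le_norm _ _ _

theorem exists_interpolant_norm_le {N : ℕ} {x : Fin (N + 2) → ℝ} (hx : StrictMono x)
    (z : Fin (N + 2) → ℝ) :
    ∃ f : BV2, (∀ m, (f : ℝ → ℝ) (x m) = z m) ∧ ‖weakD2 f‖ ≤ slopeVariation x z := by
  obtain ⟨f, h1, h2⟩ := exists_interpolant (strictMono_nodeSeq hx) (dataSeq z) N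
  exact ⟨f, (forall_node_iff x z f).2 h1, by rwa [slopeVariation_eq_sum]⟩

theorem mem_tv2Interpolants_iff {N : ℕ} {x z : Fin (N + 2) → ℝ} (hx : StrictMono x) {f : BV2} :
    f ∈ tv2Interpolants x z ↔
      (∀ m, (f : ℝ → ℝ) (x m) = z m) ∧ ‖weakD2 f‖ ≤ slopeVariation x z := by
  constructor
  · rintro ⟨h1, h2⟩
    obtain ⟨g, hg1, hg2⟩ := exists_interpolant_norm_le hx z
    exact ⟨h1, ((TV2_le_TV2_iff f g).1 (h2 g hg1)).trans hg2⟩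
  · rintro ⟨h1, h2⟩
    exact ⟨h1, fun g hg => (TV2_le_TV2_iff f g).2 (h2.trans (slopeVariation_le_norm hx hg))⟩

theorem tv2Interpolants_nonempty {N : ℕ} {x : Fin (N + 2) → ℝ} (hx : StrictMono x)
    (z : Fin (N + 2) → ℝ) : (tv2Interpolants x z).Nonempty := by
  obtain ⟨g, hg⟩ := exists_interpolant_norm_le hx z
  exact ⟨g, (mem_tv2Interpolants_iff hx).2 hg⟩

theorem TV2_eq_of_mem_tv2Interpolants {N : ℕ} {x z : Fin (N + 2) → ℝ} (hx : StrictMono x) {f : BV2}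
    (hf : f ∈ tv2Interpolants x z) : TV2 f = ENNReal.ofReal (slopeVariation x z) := by
  obtain ⟨h1, h2⟩ := (mem_tv2Interpolants_iff hx).1 hf
  rw [TV2_eq_norm, le_antisymm h2 (slopeVariation_le_norm hx h1)]

theorem convex_tv2Interpolants {N : ℕ} {x : Fin (N + 2) → ℝ} (hx : StrictMono x)
    (z : Fin (N + 2) → ℝ) : Convex ℝ (tv2Interpolants x z) := by
  intro f hf g hg a b ha hb hab
  rw [mem_tv2Interpolants_iff hx] at *
  refine ⟨fun m => ?_, ?_⟩
  · change a * (f : ℝ → ℝ) (x m) + b * (g : ℝ → ℝ) (x m) = z m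
    rw [hf.1, hg.1, ← add_mul, hab, one_mul]
  · refine norm_le_of_forall_apply_le (slopeVariation_nonneg x z) fun φ hφ => ?_
    rw [weakD2_add, weakD2_smul, weakD2_smul]
    change a * weakD2 f φ + b * weakD2 g φ ≤ _
    have h1 := (apply_le_norm (w := weakD2 f) hφ).trans hf.2
    have h2 := (apply_le_norm (w := weakD2 g) hφ).trans hg.2
    calc a * weakD2 f φ + b * weakD2 g φ
        ≤ a * slopeVariation x z + b * slopeVariation x z := by gcongr
      _ = slopeVariation x z := by rw [← add_mul, hab, one_mul]

theorem isWeakStarCompact_tv2Interpolants {N : ℕ} {x : Fin (N + 2) → ℝ} (hx : StrictMono x)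
    (z : Fin (N + 2) → ℝ) : IsWeakStarCompact (tv2Interpolants x z) := by
  have h01 : x 0 < x 1 := hx Fin.zero_lt_one
  let Ψ : WeakDual ℝ C₀(ℝ, ℝ) → BV2 := fun w =>
    BV2.ofD2 h01 (z 0) (z 1) (WeakDual.toStrongDual w)
  have hpt : ∀ s, Continuous fun w => (Ψ w : ℝ → ℝ) s := fun s =>
    continuous_const.add (WeakDual.eval_continuous (peanoC0 h01 s))
  have hΨ : @Continuous _ _ _ BV2.weakStar Ψ := by
    refine continuous_induced_rng.2 ?_
    refine Continuous.prodMk ?_ ((hpt 0).prodMk (hpt 1))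
    have : ((fun w => StrongDual.toWeakDual (weakD2 (Ψ w))) : _ → WeakDual ℝ C₀(ℝ, ℝ)) = id := by
      funext w
      rw [weakD2_ofD2]
      rfl
    rw [this]
    exact continuous_id
  have hball : ∀ u : StrongDual ℝ C₀(ℝ, ℝ),
      u ∈ Metric.closedBall (0 : StrongDual ℝ C₀(ℝ, ℝ)) (slopeVariation x z)
        ↔ ‖u‖ ≤ slopeVariation x z := fun u => by
    have h : dist u 0 = ‖u‖ := dist_zero_right u
    rw [Metric.mem_closedBall, h]
  have himg : tv2Interpolants x z = Ψ '' ((WeakDual.toStrongDual ⁻¹'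
      Metric.closedBall (0 : StrongDual ℝ C₀(ℝ, ℝ)) (slopeVariation x z)) ∩
        ⋂ m, {w | (Ψ w : ℝ → ℝ) (x m) = z m}) := by
    ext f
    rw [mem_tv2Interpolants_iff hx]
    constructor
    · rintro ⟨h1, h2⟩
      have hf : Ψ (StrongDual.toWeakDual (weakD2 f)) = f := by
        have := BV2.eq_ofD2 h01 f
        rw [h1, h1] at this
        exact this.symm
      refine ⟨StrongDual.toWeakDual (weakD2 f), ⟨?_, ?_⟩, hf⟩
      · exact (hball (weakD2 f)).2 h2
      · exact Set.mem_iInter.2 fun m => by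
          change (Ψ _ : ℝ → ℝ) (x m) = z m
          rw [hf, h1]
    · rintro ⟨w, ⟨h1, h2⟩, rfl⟩
      refine ⟨fun m => Set.mem_iInter.1 h2 m, ?_⟩
      rw [weakD2_ofD2]
      exact (hball _).1 h1
  rw [IsWeakStarCompact, himg]
  refine @IsCompact.image _ _ _ BV2.weakStar _ _ ?_ hΨ
  exact (WeakDual.isCompact_closedBall 0 _).inter_right
    (isClosed_iInter fun m => isClosed_eq (hpt (x m)) continuous_const)

theorem isLinearSpline_of_extreme {N : ℕ} {x z : Fin (N + 2) → ℝ} (hx : StrictMono x) {f : BV2}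
    (hf : f ∈ (tv2Interpolants x z).extremePoints ℝ) : IsLinearSpline f (N + 1) := by
  have hX := strictMono_nodeSeq hx
  obtain ⟨hfK, hext⟩ := hf
  obtain ⟨h1, h2⟩ := (mem_tv2Interpolants_iff hx).1 hfK
  have hnode := (forall_node_iff x z f).1 h1
  have hmem : ∀ g : BV2, (∀ m ≤ N + 1, (g : ℝ → ℝ) (nodeSeq x m) = (f : ℝ → ℝ) (nodeSeq x m)) →
      ‖weakD2 g‖ ≤ ‖weakD2 f‖ → g ∈ tv2Interpolants x z := fun g hg hn =>
    (mem_tv2Interpolants_iff hx).2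
      ⟨(forall_node_iff x z g).2 fun m hm => (hg m hm).trans (hnode m hm), hn.trans h2⟩
  refine isLinearSpline_of_knotSet f.2.1 fun S hS =>
    card_le_of_subset_knotSet (fun k : Fin N => hatSeq hX k) (fun ρ hρ φ => ?_) hS
  refine mulDual_eq_zero_of_extreme hX (N := N) (by rwa [abs_weakD2_hatSeq hx h1])
    (fun g h hg hh hgn hhn hgh => ?_) (fun k hk => hρ ⟨k, hk⟩) φ
  refine hext (hmem g hg hgn) (hmem h hh hhn)
    ⟨2⁻¹, 2⁻¹, by norm_num, by norm_num, by norm_num, ?_⟩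
  rw [← smul_add, hgh, smul_smul]
  norm_num

/-! ### The Lipschitz constraint -/

theorem lipConst_le_iff {f : ℝ → ℝ} {L : ℝ} (hL : 0 ≤ L) :
    lipConst f ≤ ENNReal.ofReal L ↔ ∀ u v, |f v - f u| ≤ L * |v - u| := by
  simp only [lipConst, iSup_le_iff]
  constructor
  · intro h u v
    rcases eq_or_ne v u with rfl | hne
    · simp
    · have := (ENNReal.ofReal_le_ofReal_iff hL).1 (h v u hne)
      rwa [div_le_iff₀ (abs_pos.2 (sub_ne_zero.2 hne))] at this
  · intro h u v hne
    refine ENNReal.ofReal_le_ofReal ?_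
    rw [div_le_iff₀ (abs_pos.2 (sub_ne_zero.2 hne))]
    exact h v u

theorem abs_seqSlope_le {f : ℝ → ℝ} {L : ℝ} (h : ∀ u v, |f v - f u| ≤ L * |v - u|) {X : ℕ → ℝ}
    (hX : StrictMono X) (k : ℕ) : |seqSlope f X k| ≤ L := by
  have hpos : 0 < |X (k + 1) - X k| := abs_pos.2 (sub_ne_zero.2 (hX k.lt_succ_self).ne')
  rw [seqSlope, abs_div, div_le_iff₀ hpos]
  exact h _ _

/-- The data all of whose slopes are at most `L` in absolute value. -/
def slopeBounded {N : ℕ} (x : Fin (N + 2) → ℝ) (L : ℝ) : Set (Fin (N + 2) → ℝ) :=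
  {z | ∀ k ≤ N, |nodeSlope (nodeSeq x) (dataSeq z) k| ≤ L}

theorem isClosed_slopeBounded {N : ℕ} (x : Fin (N + 2) → ℝ) (L : ℝ) :
    IsClosed (slopeBounded x L) := by
  have : slopeBounded x L
      = ⋂ k ≤ N, {z | |nodeSlope (nodeSeq x) (dataSeq z) k| ≤ L} := by
    ext z
    simp [slopeBounded]
  rw [this]
  exact isClosed_biInter fun k _ => isClosed_le (continuous_nodeSlope _ _ k).abs continuous_const

theorem zero_mem_slopeBounded {N : ℕ} (x : Fin (N + 2) → ℝ) {L : ℝ} (hL : 0 ≤ L) :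
    0 ∈ slopeBounded x L := fun k _ => by
  simpa [nodeSlope, dataSeq] using hL

theorem midpoint_mem_slopeBounded {N : ℕ} {x : Fin (N + 2) → ℝ} {L : ℝ} {z z' : Fin (N + 2) → ℝ}
    (hz : z ∈ slopeBounded x L) (hz' : z' ∈ slopeBounded x L) :
    (2⁻¹ : ℝ) • (z + z') ∈ slopeBounded x L := fun k hk => by
  rw [nodeSlope_midpoint]
  linarith [abs_half_add_le (nodeSlope (nodeSeq x) (dataSeq z) k)
    (nodeSlope (nodeSeq x) (dataSeq z') k), hz k hk, hz' k hk]

theorem mem_slopeBounded_of_lipConst_le {N : ℕ} {x : Fin (N + 2) → ℝ} (hx : StrictMono x) {L : ℝ}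
    (hL : 0 ≤ L) {f : ℝ → ℝ} (hf : lipConst f ≤ ENNReal.ofReal L) :
    (fun m => f (x m)) ∈ slopeBounded x L := fun k hk => by
  rw [nodeSlope_congr (Z' := fun n => f (nodeSeq x n)) (N := N)
    (fun m hm => ((forall_node_iff x (fun m => f (x m)) f).1 (fun _ => rfl) m hm).symm) hk]
  exact abs_seqSlope_le ((lipConst_le_iff hL).1 hf) (strictMono_nodeSeq hx) k

theorem lipConst_le_of_mem_tv2Interpolants {N : ℕ} {x z : Fin (N + 2) → ℝ} (hx : StrictMono x)
    {L : ℝ} (hL : 0 ≤ L) (hz : z ∈ slopeBounded x L) {f : BV2} (hf : f ∈ tv2Interpolants x z) :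
    lipConst f ≤ ENNReal.ofReal L := by
  obtain ⟨h1, h2⟩ := (mem_tv2Interpolants_iff hx).1 hf
  refine (lipConst_le_iff hL).2 (abs_sub_le_of_norm_le (strictMono_nodeSeq hx) (N := N)
    (by rwa [abs_weakD2_hatSeq hx h1]) fun j hj => ?_)
  rw [seqSlope_eq_nodeSlope, nodeSlope_congr (N := N) ((forall_node_iff x z f).1 h1) hj]
  exact hz j hj

theorem hybridCost_eq {M : ℕ} (E : ℝ → ℝ → ℝ) (x y : Fin M → ℝ) (lam : ℝ) (f : BV2) :
    hybridCost E x y lam f = ∑ m, E ((f : ℝ → ℝ) (x m)) (y m) + lam * ‖weakD2 f‖ := by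
  rw [hybridCost, toReal_TV2]

theorem le_hybridCost {N : ℕ} (E : ℝ → ℝ → ℝ) {x : Fin (N + 2) → ℝ} (hx : StrictMono x)
    (y : Fin (N + 2) → ℝ) {lam : ℝ} (hlam : 0 ≤ lam) (f : BV2) :
    ∑ m, E ((f : ℝ → ℝ) (x m)) (y m) + lam * slopeVariation x (fun m => (f : ℝ → ℝ) (x m))
      ≤ hybridCost E x y lam f := by
  rw [hybridCost_eq]
  have := slopeVariation_le_norm hx (f := f) (fun _ => rfl)
  gcongr

theorem hybridCost_of_mem_tv2Interpolants {N : ℕ} (E : ℝ → ℝ → ℝ) {x z : Fin (N + 2) → ℝ}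
    (hx : StrictMono x) (y : Fin (N + 2) → ℝ) (lam : ℝ) {f : BV2} (hf : f ∈ tv2Interpolants x z) :
    hybridCost E x y lam f = ∑ m, E (z m) (y m) + lam * slopeVariation x z := by
  obtain ⟨h1, h2⟩ := (mem_tv2Interpolants_iff hx).1 hf
  rw [hybridCost_eq, le_antisymm h2 (slopeVariation_le_norm hx h1)]
  simp only [h1]

theorem exists_hybridSolutions_eq_tv2Interpolants {N : ℕ} {x : Fin (N + 2) → ℝ} (hx : StrictMono x)
    (y : Fin (N + 2) → ℝ) (E : ℝ → ℝ → ℝ)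
    (hE_convex : ∀ v, StrictConvexOn ℝ Set.univ (fun u => E u v))
    (hE_coercive : ∀ v, Filter.Tendsto (fun u => E u v) (Filter.cocompact ℝ) Filter.atTop)
    {lam Lbar : ℝ} (hlam : 0 < lam) (hLbar : 0 ≤ Lbar) :
    ∃ z : Fin (N + 2) → ℝ, hybridSolutions E x y lam Lbar = tv2Interpolants x z := by
  obtain ⟨z, hz, hmin, huniq⟩ := exists_unique_min_of_strictConvex E y hE_convex hE_coercive
    (R := fun z => lam * slopeVariation x z) (continuous_const.mul (continuous_slopeVariation x))
    (fun z => mul_nonneg hlam.le (slopeVariation_nonneg x z))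
    (fun z z' => by nlinarith [slopeVariation_midpoint_le x z z'])
    (isClosed_slopeBounded x Lbar) ⟨0, zero_mem_slopeBounded x hLbar⟩
    (fun z hz z' hz' => midpoint_mem_slopeBounded hz hz')
  refine ⟨z, Set.Subset.antisymm (fun f hf => ?_) fun f hf => ?_⟩
  · obtain ⟨g, hg⟩ := tv2Interpolants_nonempty hx z
    have h1 := hf.2 g (lipConst_le_of_mem_tv2Interpolants hx hLbar hz hg)
    rw [hybridCost_of_mem_tv2Interpolants E hx y lam hg] at h1
    have hfz : (fun m => (f : ℝ → ℝ) (x m)) = z :=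
      huniq _ (mem_slopeBounded_of_lipConst_le hx hLbar hf.1)
        ((le_hybridCost E hx y hlam.le f).trans h1)
    have hfz' : ∀ m, (f : ℝ → ℝ) (x m) = z m := congrFun hfz
    refine (mem_tv2Interpolants_iff hx).2 ⟨hfz', ?_⟩
    rw [hybridCost_eq] at h1
    simp only [hfz'] at h1
    exact le_of_mul_le_mul_left (le_of_add_le_add_left h1) hlam
  · refine ⟨lipConst_le_of_mem_tv2Interpolants hx hLbar hz hf, fun g hg => ?_⟩
    rw [hybridCost_of_mem_tv2Interpolants E hx y lam hf]
    exact (hmin _ (mem_slopeBounded_of_lipConst_le hx hLbar hg)).trans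
      (le_hybridCost E hx y hlam.le g)

theorem theorem3 {M : ℕ} (hM : 2 ≤ M) (x y : Fin M → ℝ) (hx : StrictMono x)
    (E : ℝ → ℝ → ℝ)
    (hE_convex : ∀ v, StrictConvexOn ℝ Set.univ (fun u => E u v))
    (hE_coercive : ∀ v, Filter.Tendsto (fun u => E u v) (Filter.cocompact ℝ) Filter.atTop)
    (lam Lbar : ℝ) (hlam : 0 < lam) (hLbar : 0 < Lbar) :
    (hybridSolutions E x y lam Lbar).Nonempty ∧
    Convex ℝ (hybridSolutions E x y lam Lbar) ∧
    IsWeakStarCompact (hybridSolutions E x y lam Lbar) ∧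
    (∀ f ∈ (hybridSolutions E x y lam Lbar).extremePoints ℝ, IsLinearSpline f (M - 1)) ∧
    ∃ z : Fin M → ℝ,
      hybridSolutions E x y lam Lbar = tv2Interpolants x z ∧
      (∀ z' : Fin M → ℝ, hybridSolutions E x y lam Lbar = tv2Interpolants x z' → z' = z) ∧
      ∀ f ∈ hybridSolutions E x y lam Lbar, TV2 f = ENNReal.ofReal (slopeVariation x z) := by
  obtain ⟨N, rfl⟩ : ∃ N, M = N + 2 := ⟨M - 2, by omega⟩
  obtain ⟨z, hz⟩ := exists_hybridSolutions_eq_tv2Interpolants hx y E hE_convex hE_coercive hlam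
    hLbar.le
  rw [hz]
  refine ⟨tv2Interpolants_nonempty hx z, convex_tv2Interpolants hx z,
    isWeakStarCompact_tv2Interpolants hx z, fun f hf => isLinearSpline_of_extreme hx hf, z, rfl,
    fun z' hz' => ?_, fun f hf => TV2_eq_of_mem_tv2Interpolants hx hf⟩
  obtain ⟨f, hf⟩ := tv2Interpolants_nonempty hx z
  have hf' : f ∈ tv2Interpolants x z' := hz' ▸ hf
  exact funext fun m => (hf'.1 m).symm.trans (hf.1 m)
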